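/- For a positive integer $n$ and a finite set $S$ of positive integers with $2\max(S)<n$, let $\langle S\rangle_n$ be the graph with vertex set $\mathbb Z_n$ in which distinct $x,y$ are adjacent if and only if $x-y\equiv \pm s \pmod n$ for some $s\in S$. For a finite graph $K$ and a list of integers $M=(m_1,\ldots,m_t)$ with all $m_i\ge 3$, an $(M)$-decomposition of $K$ is, if every vertex of $K$ has even degree, a family of subgraphs $G_1,\ldots,G_t$ of $K$ whose edge sets partition the edge set of $K$, where $G_i$ is an $m_i$-cycle (a cycle with $m_i$ edges) for each $i$; if every vertex of $K$ has odd degree, it is such a family $G_1,\ldots,G_t,I$ with in addition $I$ a perfect matching of $K$. Lists are considered up to order, and $a^{r}$ in a list denotes $r$ occurrences of $a$. Lemma. Let $$S\in\{\{1,2,3\},\{1,2,3,4\},\{1,2,3,4,6\},\{1,2,3,4,5,7\},\{1,2,3,4,5,6,7\},\{1,2,3,4,5,6,7,8\}\},$$ let $n\geq 2\max(S)+1$, and let $M=(m_1,\ldots,m_t,k)$ be any list with $m_i\in\{3,4,5\}$ for $i=1,\ldots,t$, $3\leq k\leq n$ and $m_1+\cdots+m_t+k=|S|n$. Then there is an $(M)$-decomposition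 of $\langle S\rangle_n$, except possibly when - $S=\{1,2,3,4,6\}$, $n\equiv 3\pmod 6$ and $M=(3^{5n/3})$; or - $S=\{1,2,3,4,6\}$, $n\equiv 4\pmod 6$ and $M=(3^{(5n-5)/3},5)$. -/

import Mathlib

/-- The circulant graph `⟨S⟩_n`, i.e. the Cayley graph of `ℤ/nℤ` with connection set `S ∪ -S`, where
`S` is a finite set of integers read modulo `n`. -/
def circ (n : ℕ) (S : Finset ℕ) : SimpleGraph (ZMod n) :=
  SimpleGraph.circulantGraph ((fun s : ℕ => (s : ZMod n)) '' (S : Set ℕ))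

/-- The subgraph `H` of `K` is an `m`-cycle (a cycle with `m` edges). -/
def IsCycleOfLength {V : Type*} {K : SimpleGraph V} (H : K.Subgraph) (m : ℕ) : Prop :=
  ∃ (v : V) (p : K.Walk v v), p.IsCycle ∧ p.length = m ∧ H = p.toSubgraph

/-- The edge sets of the subgraphs `G i` partition the edge set of `K`. -/
def IsDecomposition {V ι : Type*} (K : SimpleGraph V) (G : ι → K.Subgraph) : Prop :=
  Pairwise (fun i j => Disjoint (G i).edgeSet (G j).edgeSet) ∧
    (⋃ i, (G i).edgeSet) = K.edgeSet

/-- There is an `(M)`-decomposition of the finite graph `K`. If every vertex of `K` has even degree,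
this is a decomposition into cycles whose lengths are the entries of `M`. If every vertex of `K` has
odd degree, it is a decomposition into such cycles together with one perfect matching (the member of
index `none`). -/
def HasDecomposition {V : Type*} [Finite V] (K : SimpleGraph V) (M : List ℕ) : Prop :=
  ((∀ v, Even (K.neighborSet v).ncard) ∧
    ∃ G : Fin M.length → K.Subgraph,
      (∀ i, IsCycleOfLength (G i) (M.get i)) ∧ IsDecomposition K G) ∨
  ((∀ v, Odd (K.neighborSet v).ncard) ∧
    ∃ G : Option (Fin M.length) → K.Subgraph,
      (∀ i, IsCycleOfLength (G (some i)) (M.get i)) ∧ (G none).IsPerfectMatching ∧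
        IsDecomposition K G)

/-!
The circulant graph `⟨S⟩_n` is the quotient of an infinite strip: the graph on the integers in which
`i` and `i + s` are joined for `s ∈ S`, taken modulo translation by `n`. Decompositions are glued
together from finite segments of the strip. The region of edges to the left of a boundary is a
staircase, which for each length `s` contains the edges `(i, s)` with `i` below a bound that depends
on `s`. If the edges of a family of cycles fill up the region between a staircase and its translate
by `l`, then such families can be put side by side, and for `l = n` the two staircases cancel modulo
`n`, so that every edge of `⟨S⟩_n` is used exactly once (`Closed.hasDecomposition`). All cycles
span so few integers that their vertices remain distinct modulo `n`.

Every short cycle lies within one segment. A cycle of arbitrary length `k ≤ n` runs across many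
segments: an opening segment contains a path whose two ends stick out at the right boundary, passing
segments prolong it at its two ends, in total by as many edges as they have columns
(`Opening.pass`), and a closing segment joins the two ends (`Opening.close`). The path zigzags
within a window that moves along with the columns, so the finished cycle fits into `n` consecutive
integers.

For each of the six sets `S` a finite atlas of explicit segments suffices. If `n` is large, then one
of the numbers of triangles, quadrilaterals and pentagons is so large that a closed or passing
segment all of whose short cycles have this one length can be removed, which reduces `n` by at most
six (`extend_cover₀`, `extend_cover`). The remaining lists are finitely many, and a kernel
computation checks that each of them arises from segments of the atlas (`coverTest₀`, `coverTest`).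
Only the lists of one hexagon and triangles for five differences and `n ≡ 3` modulo `6` are treated
separately: there a block of nine columns contains the hexagon, and closed segments of six columns
consisting of triangles do the rest (`closed_hexagon`).
-/

namespace StripDecomposition

/-! ### Edges and staircases of the strip -/

/-- The edge of the strip joining `u` and `v`, recorded as its left end and its length. -/
def edge (u v : ℕ) : ℕ × ℕ := bif Nat.ble u v then (u, v - u) else (v, u - v)

/-- The edges of the path that visits the listed vertices in order. -/
def pathEdges : List ℕ → List (ℕ × ℕ)
  | u :: v :: l => edge u v :: pathEdges (v :: l)
  | _ => []

/-- The edges of the cycle that visits the listed vertices in order and then returns. -/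
def cycleEdges : List ℕ → List (ℕ × ℕ)
  | [] => []
  | u :: l => pathEdges (u :: (l ++ [u]))

/-- The edges of a list of cycles. -/
def cyclesEdges (C : List (List ℕ)) : List (ℕ × ℕ) := C.flatMap cycleEdges

/-- The staircase region of edges described by a profile `D`, a list of pairs (length, offset), at
position `p`: it contains the edges of length `s` with left end below `p` plus the offset of `s`. -/
def fill (D : List (ℕ × ℕ)) (p : ℕ) : List (ℕ × ℕ) :=
  D.flatMap fun q => (List.range (p + q.2)).map fun i => (i, q.1)

/-- All edges with length in `S` and left end below `p`. -/
def box (S : List ℕ) (p : ℕ) : List (ℕ × ℕ) :=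
  S.flatMap fun s => (List.range p).map fun i => (i, s)

/-- Translation of edges by `p`. -/
def shift (p : ℕ) (e : ℕ × ℕ) : ℕ × ℕ := (e.1 + p, e.2)

/-- Translation of a list of vertices by `p`. -/
def slide (p : ℕ) (l : List ℕ) : List ℕ := l.map (· + p)

theorem edge_comm (u v : ℕ) : edge u v = edge v u := by
  unfold edge
  rcases lt_trichotomy u v with h | h | h
  · have h1 : Nat.ble u v = true := by simpa using h.le
    have h2 : Nat.ble v u = false := by
      rw [← Bool.not_eq_true]; simpa using h
    simp [h1, h2]
  · simp [h]
  · have h1 : Nat.ble v u = true := by simpa using h.le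
    have h2 : Nat.ble u v = false := by
      rw [← Bool.not_eq_true]; simpa using h
    simp [h1, h2]

theorem edge_add (p u v : ℕ) : edge (u + p) (v + p) = shift p (edge u v) := by
  unfold edge shift
  have : Nat.ble (u + p) (v + p) = Nat.ble u v := by
    rw [Bool.eq_iff_iff]; simp
  rw [this]
  cases Nat.ble u v <;> simp <;> omega

theorem pathEdges_slide (p : ℕ) (l : List ℕ) :
    pathEdges (slide p l) = (pathEdges l).map (shift p) := by
  induction l with
  | nil => rfl
  | cons u l ih =>
    cases l with
    | nil => rfl
    | cons v l => simpa [slide, pathEdges, edge_add] using ih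

theorem cycleEdges_slide (p : ℕ) (l : List ℕ) :
    cycleEdges (slide p l) = (cycleEdges l).map (shift p) := by
  cases l with
  | nil => rfl
  | cons u l =>
    have := pathEdges_slide p (u :: (l ++ [u]))
    simpa [slide, cycleEdges] using this

theorem cyclesEdges_slide (p : ℕ) (C : List (List ℕ)) :
    cyclesEdges (C.map (slide p)) = (cyclesEdges C).map (shift p) := by
  simp [cyclesEdges, List.map_flatMap, List.flatMap_map, cycleEdges_slide]

theorem pathEdges_append_cons (l m : List ℕ) (a : ℕ) :
    pathEdges (l ++ a :: m) = pathEdges (l ++ [a]) ++ pathEdges (a :: m) := by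
  induction l with
  | nil => simp [pathEdges]
  | cons u l ih =>
    cases l with
    | nil => simp [pathEdges]
    | cons v l => simpa [pathEdges] using ih

theorem pathEdges_append_right {P : List ℕ} {b : ℕ} (h : P.getLast? = some b) (Y : List ℕ) :
    pathEdges (P ++ Y) = pathEdges P ++ pathEdges (b :: Y) := by
  obtain ⟨Q, rfl⟩ := List.getLast?_eq_some_iff.1 h
  simpa using pathEdges_append_cons Q Y b

theorem pathEdges_reverse (l : List ℕ) : (pathEdges l.reverse).Perm (pathEdges l) := by
  induction l with
  | nil => rfl
  | cons u l ih =>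
    cases l with
    | nil => rfl
    | cons v l =>
      have := pathEdges_append_cons l.reverse [u] v
      simp only [List.reverse_cons, List.append_assoc, List.singleton_append] at this ih ⊢
      rw [this]
      simp only [pathEdges, edge_comm u v]
      exact (ih.append_right _).trans List.perm_append_comm

theorem pathEdges_append_left {P : List ℕ} {a : ℕ} (h : P.head? = some a) (X : List ℕ) :
    (pathEdges (X.reverse ++ P)).Perm (pathEdges (a :: X) ++ pathEdges P) := by
  obtain ⟨Q, rfl⟩ := List.head?_eq_some_iff.1 h
  rw [pathEdges_append_cons]
  have := pathEdges_reverse (a :: X)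
  simp only [List.reverse_cons] at this
  exact this.append_right _

theorem fill_add (D : List (ℕ × ℕ)) (p q : ℕ) :
    (fill D (p + q)).Perm (box (D.map Prod.fst) p ++ (fill D q).map (shift p)) := by
  unfold fill box
  rw [List.flatMap_map, List.map_flatMap]
  refine List.Perm.trans ?_ (List.flatMap_append_perm _ _ _).symm
  refine List.Perm.of_eq (List.flatMap_congr fun x _ => ?_)
  simp only [Nat.add_assoc, List.range_add (n := p), List.map_append, List.map_map]
  congr 1
  refine List.map_congr_left fun i _ => ?_
  simp [shift, Nat.add_comm]

/-- The edges `E` fill up the region between profile `D₁` at position `0` and profile `D₂` at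
position `l`. -/
def Fills (D₁ D₂ : List (ℕ × ℕ)) (l : ℕ) (E : Multiset (ℕ × ℕ)) : Prop :=
  E + (fill D₁ 0 : Multiset (ℕ × ℕ)) = (fill D₂ l : Multiset (ℕ × ℕ))

theorem Fills.add {D₁ D₂ D₃ : List (ℕ × ℕ)} {l l' : ℕ} {E E' : Multiset (ℕ × ℕ)}
    (hD : D₂.map Prod.fst = D₃.map Prod.fst) (h : Fills D₁ D₂ l E) (h' : Fills D₂ D₃ l' E') :
    Fills D₁ D₃ (l + l') (E + E'.map (shift l)) := by
  unfold Fills at *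
  have h1 := Multiset.coe_eq_coe.2 (fill_add D₂ l 0)
  have h2 := Multiset.coe_eq_coe.2 (fill_add D₃ l l')
  rw [← Multiset.coe_add, ← Multiset.map_coe] at h1 h2
  rw [Nat.add_zero] at h1
  rw [h2, ← h', Multiset.map_add, ← hD, add_right_comm, h, h1]
  abel

/-! ### Segments and their composition -/

section

/-- The cycle `c` has no repeated vertex, and its vertices lie within `d` consecutive integers, so
that they remain distinct modulo every `n ≥ d`. -/
def Narrow (d : ℕ) (c : List ℕ) : Prop := c.Nodup ∧ ∀ u ∈ c, ∀ v ∈ c, u < v + d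

/-- The multiset of lengths of a list of cycles. -/
def lengths (C : List (List ℕ)) : Multiset ℕ := (C.map List.length : List ℕ)

/-- The data of a strip: the profile `A` between two pieces when no long cycle is open, the profile
`B` when the two ends of an open path cross the boundary, the offsets `lo` and `hi` from which
vertices of the long cycle belong to what follows the boundary (for `A` and `B` respectively), and
the offsets `x`, `y` of the two ends of the open path. -/
structure Frame where
  A : List (ℕ × ℕ)
  B : List (ℕ × ℕ)
  lo : ℕ
  hi : ℕ
  x : ℕ
  y : ℕ

variable (F : Frame) (d : ℕ)

/-- A closed segment of `l` columns, decomposed into cycles with lengths `L`. -/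
def Closed (l : ℕ) (L : Multiset ℕ) : Prop :=
  ∃ C, lengths C = L ∧ (∀ c ∈ C, Narrow d c) ∧ Fills F.A F.A l (cyclesEdges C)

/-- An opening segment of `l` columns, decomposed into cycles with lengths `L` and a path with `k`
edges whose ends are the two terminals of the right boundary. -/
def Opening (l k : ℕ) (L : Multiset ℕ) : Prop :=
  ∃ C P, lengths C = L ∧ (∀ c ∈ C, Narrow d c) ∧ P.Nodup ∧ (∀ v ∈ P, F.lo ≤ v ∧ v < l + F.hi) ∧
    P.head? = some (l + F.x) ∧ P.getLast? = some (l + F.y) ∧ P.length = k + 1 ∧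
    Fills F.A F.B l (cyclesEdges C + pathEdges P)

/-- A passing segment of `l` columns, decomposed into cycles with lengths `L` and two disjoint paths
with `k` edges in total that continue an open path from the left terminals to the right ones. -/
def Passing (l k : ℕ) (L : Multiset ℕ) : Prop :=
  ∃ C X Y, lengths C = L ∧ (∀ c ∈ C, Narrow d c) ∧ (X ++ Y).Nodup ∧
    (∀ v ∈ X ++ Y, F.hi ≤ v ∧ v < l + F.hi) ∧
    ((X.getLastD F.x = l + F.x ∧ Y.getLastD F.y = l + F.y) ∨
      (X.getLastD F.x = l + F.y ∧ Y.getLastD F.y = l + F.x)) ∧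
    X.length + Y.length = k ∧
    Fills F.B F.B l (cyclesEdges C + (pathEdges (F.x :: X) + pathEdges (F.y :: Y)))

/-- A closing segment of `l` columns, decomposed into cycles with lengths `L` and a path with `k`
edges that joins the two left terminals. -/
def Closing (l k : ℕ) (L : Multiset ℕ) : Prop :=
  F.hi ≤ l + F.lo ∧ ∃ C Z, lengths C = L ∧ (∀ c ∈ C, Narrow d c) ∧ Z.Nodup ∧
    (∀ v ∈ Z, F.hi ≤ v ∧ v < l + F.lo) ∧ Z.length + 1 = k ∧
    Fills F.B F.A l (cyclesEdges C + pathEdges (F.y :: (Z ++ [F.x])))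

variable {F d}

theorem slide_length (p : ℕ) (l : List ℕ) : (slide p l).length = l.length := by simp [slide]

theorem lengths_append_slide (C C' : List (List ℕ)) (p : ℕ) :
    lengths (C ++ C'.map (slide p)) = lengths C + lengths C' := by
  simp [lengths, Function.comp_def, slide_length]

theorem Narrow.slide {c : List ℕ} (h : Narrow d c) (p : ℕ) : Narrow d (slide p c) := by
  refine ⟨h.1.map (fun a b => by simp), ?_⟩
  simp only [StripDecomposition.slide, List.mem_map, forall_exists_index, and_imp,
    forall_apply_eq_imp_iff₂]
  intro u hu v hv
  have := h.2 u hu v hv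
  omega

theorem narrow_append_slide {C C' : List (List ℕ)} (h : ∀ c ∈ C, Narrow d c)
    (h' : ∀ c ∈ C', Narrow d c) (p : ℕ) : ∀ c ∈ C ++ C'.map (slide p), Narrow d c := by
  intro c hc
  rcases List.mem_append.1 hc with hc | hc
  · exact h c hc
  · obtain ⟨c', hc', rfl⟩ := List.mem_map.1 hc
    exact (h' c' hc').slide p

theorem cyclesEdges_append_slide (C C' : List (List ℕ)) (p : ℕ) :
    (cyclesEdges (C ++ C'.map (slide p)) : Multiset (ℕ × ℕ)) =
      cyclesEdges C + (cyclesEdges C' : Multiset (ℕ × ℕ)).map (shift p) := by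
  have := cyclesEdges_slide p C'
  simp only [cyclesEdges] at this ⊢
  rw [List.flatMap_append, ← Multiset.coe_add, this, Multiset.map_coe]

theorem mem_slide {p v : ℕ} {l : List ℕ} : v ∈ slide p l ↔ ∃ u ∈ l, u + p = v := by
  simp [slide]

theorem Closed.add {l l' : ℕ} {L L' : Multiset ℕ} (h : Closed F d l L) (h' : Closed F d l' L') :
    Closed F d (l + l') (L + L') := by
  obtain ⟨C, rfl, hn, hf⟩ := h
  obtain ⟨C', rfl, hn', hf'⟩ := h'
  refine ⟨C ++ C'.map (slide l), lengths_append_slide _ _ _, narrow_append_slide hn hn' l, ?_⟩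
  rw [cyclesEdges_append_slide]
  exact hf.add rfl hf'

theorem nodup_slide {l : List ℕ} (h : l.Nodup) (p : ℕ) : (slide p l).Nodup :=
  h.map fun a b => by simp

theorem slide_append (p : ℕ) (l m : List ℕ) : slide p (l ++ m) = slide p l ++ slide p m := by
  simp [slide]

theorem getLast?_append_slide {P X : List ℕ} {l x : ℕ} (h : P.getLast? = some (l + x)) :
    (P ++ slide l X).getLast? = some (X.getLastD x + l) := by
  rcases List.eq_nil_or_concat X with rfl | ⟨Q, z, rfl⟩
  · simp [slide, h, Nat.add_comm]
  · simp [slide, ← List.append_assoc, List.getLastD_eq_getLast?]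

theorem pathEdges_slide_coe (p : ℕ) (l : List ℕ) :
    (pathEdges (slide p l) : Multiset (ℕ × ℕ)) = Multiset.map (shift p) (pathEdges l) := by
  rw [pathEdges_slide, Multiset.map_coe]

/-- A passing segment prolongs an open path at both of its ends. The two ends may get swapped, in
which case the path is read backwards. -/
theorem Opening.pass {l k l' k' : ℕ} {L L' : Multiset ℕ}
    (h : Opening F d l k L) (h' : Passing F d l' k' L') :
    Opening F d (l + l') (k + k') (L + L') := by
  obtain ⟨C, P, rfl, hn, hP, hb, hx, hy, hk, hf⟩ := h
  obtain ⟨C', X, Y, rfl, hn', hXY, hb', ht, rfl, hf'⟩ := h'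
  have hhead : ((slide l X).reverse ++ (P ++ slide l Y)).head? = some (X.getLastD F.x + l) := by
    have := getLast?_append_slide (X := X) (l := l) (x := F.x) (P := P.reverse) (by simpa using hx)
    have hPne : P ≠ [] := by rintro rfl; simp at hx
    rw [← List.append_assoc, List.head?_append_of_ne_nil _ (by simp [hPne]), ← this,
      ← List.head?_reverse]
    simp
  have hlast : ((slide l X).reverse ++ (P ++ slide l Y)).getLast? = some (Y.getLastD F.y + l) := by
    have hPne : P ≠ [] := by rintro rfl; simp at hx
    rw [List.getLast?_append_of_ne_nil _ (by simp [hPne]), getLast?_append_slide hy]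
  have hnd : ((slide l X).reverse ++ (P ++ slide l Y)).Nodup := by
    have h1 : (P ++ slide l (X ++ Y)).Nodup := by
      refine hP.append (nodup_slide hXY l) ?_
      intro v hv hv'
      obtain ⟨u, hu, rfl⟩ := mem_slide.1 hv'
      have := hb _ hv
      have := hb' _ hu
      omega
    rw [slide_append] at h1
    refine (List.Perm.nodup_iff ?_).1 h1
    refine List.Perm.trans ?_ ((List.reverse_perm _).symm.append_right _)
    rw [← List.append_assoc, ← List.append_assoc]
    exact List.perm_append_comm.append_right _
  have hedges : (pathEdges ((slide l X).reverse ++ (P ++ slide l Y)) : Multiset (ℕ × ℕ)) =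
      pathEdges P + (Multiset.map (shift l) (pathEdges (F.x :: X)) +
        Multiset.map (shift l) (pathEdges (F.y :: Y))) := by
    have hPne : P ≠ [] := by rintro rfl; simp at hx
    have h1 := Multiset.coe_eq_coe.2 (pathEdges_append_left (P := P ++ slide l Y) (a := l + F.x)
      (by rw [List.head?_append_of_ne_nil _ hPne, hx]) (slide l X))
    rw [h1, pathEdges_append_right hy, ← Multiset.coe_add, ← Multiset.coe_add,
      ← pathEdges_slide_coe, ← pathEdges_slide_coe]
    simp only [slide, List.map_cons, Nat.add_comm F.x, Nat.add_comm F.y]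
    abel
  have hbd : ∀ v ∈ (slide l X).reverse ++ (P ++ slide l Y), F.lo ≤ v ∧ v < l + l' + F.hi := by
    have hlh : ∀ u, F.hi ≤ u → F.lo ≤ u + l := by
      intro u hu
      have := hb (l + F.x) (List.mem_of_head? hx)
      omega
    intro v hv
    simp only [List.mem_append, List.mem_reverse, mem_slide] at hv
    rcases hv with ⟨u, hu, rfl⟩ | hv | ⟨u, hu, rfl⟩
    · have := hb' u (by simp [hu])
      have := hlh u this.1
      omega
    · have := hb v hv
      have : l + F.hi ≤ l + l' + F.hi := by omega
      omega
    · have := hb' u (by simp [hu])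
      have := hlh u this.1
      omega
  have hfill : Fills F.A F.B (l + l') (cyclesEdges (C ++ C'.map (slide l)) +
      pathEdges ((slide l X).reverse ++ (P ++ slide l Y))) := by
    have := hf.add rfl hf'
    rw [cyclesEdges_append_slide, hedges]
    simp only [Multiset.map_add] at this
    convert this using 1
    abel
  have hlen : ((slide l X).reverse ++ (P ++ slide l Y)).length = k + (X.length + Y.length) + 1 := by
    simp [slide_length, hk]; omega
  rcases ht with ⟨h1, h2⟩ | ⟨h1, h2⟩
  · refine ⟨C ++ C'.map (slide l), _, lengths_append_slide _ _ _, narrow_append_slide hn hn' l, hnd,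
      hbd, ?_, ?_, hlen, hfill⟩
    · rw [hhead, h1]; congr 1; omega
    · rw [hlast, h2]; congr 1; omega
  · refine ⟨C ++ C'.map (slide l), ((slide l X).reverse ++ (P ++ slide l Y)).reverse,
      lengths_append_slide _ _ _, narrow_append_slide hn hn' l, List.nodup_reverse.2 hnd,
      fun v hv => hbd v (List.mem_reverse.1 hv), ?_, ?_, ?_, ?_⟩
    · rw [List.head?_reverse, hlast, h2]; congr 1; omega
    · rw [List.getLast?_reverse, hhead, h1]; congr 1; omega
    · rw [List.length_reverse, hlen]
    · rwa [Multiset.coe_eq_coe.2 (pathEdges_reverse _)]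

/-- A closing segment completes an open path to a cycle. This cycle lies in a window of as many
integers as there are columns in total, so it is narrow as soon as this number is at most `d`. -/
theorem Opening.close {l k l' k' : ℕ} {L L' : Multiset ℕ}
    (hAB : F.A.map Prod.fst = F.B.map Prod.fst) (hd : l + l' ≤ d)
    (h : Opening F d l k L) (h' : Closing F d l' k' L') :
    Closed F d (l + l') (L + L' + {k + k'}) := by
  obtain ⟨C, P, rfl, hn, hP, hb, hx, hy, hk, hf⟩ := h
  obtain ⟨hl, C', Z, rfl, hn', hZ, hb', rfl, hf'⟩ := h'
  have hbd : ∀ v ∈ P ++ slide l Z, F.lo ≤ v ∧ v < l + l' + F.lo := by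
    intro v hv
    have h0 := hb (l + F.x) (List.mem_of_head? hx)
    rcases List.mem_append.1 hv with hv | hv
    · have := hb v hv
      omega
    · obtain ⟨u, hu, rfl⟩ := mem_slide.1 hv
      have := hb' u hu
      omega
  have hlong : Narrow d (P ++ slide l Z) := by
    refine ⟨hP.append (nodup_slide hZ l) ?_, ?_⟩
    · intro v hv hv'
      obtain ⟨u, hu, rfl⟩ := mem_slide.1 hv'
      have := hb _ hv
      have := hb' _ hu
      omega
    · intro u hu v hv
      have := hbd u hu
      have := hbd v hv
      omega
  have hedges : (cycleEdges (P ++ slide l Z) : Multiset (ℕ × ℕ)) =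
      pathEdges P + Multiset.map (shift l) (pathEdges (F.y :: (Z ++ [F.x]))) := by
    obtain ⟨Q, rfl⟩ := List.head?_eq_some_iff.1 hx
    have := pathEdges_append_right hy (slide l Z ++ [l + F.x])
    rw [← pathEdges_slide_coe, Multiset.coe_add]
    simp only [slide, List.map_cons, Nat.add_comm F.x, Nat.add_comm F.y, List.map_append,
      cycleEdges, List.cons_append, List.append_assoc, List.map_nil] at this ⊢
    rw [this]
  refine ⟨(C ++ C'.map (slide l)) ++ [P ++ slide l Z], ?_, ?_, ?_⟩
  · have := lengths_append_slide C C' l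
    unfold lengths at this ⊢
    rw [List.map_append, ← Multiset.coe_add, this]
    simp [slide_length, hk]
    omega
  · intro c hc
    rcases List.mem_append.1 hc with hc | hc
    · exact narrow_append_slide hn hn' l c hc
    · rw [List.mem_singleton.1 hc]; exact hlong
  · have := hf.add hAB.symm hf'
    have h2 : (cyclesEdges ((C ++ C'.map (slide l)) ++ [P ++ slide l Z]) : Multiset (ℕ × ℕ)) =
        cyclesEdges (C ++ C'.map (slide l)) + cycleEdges (P ++ slide l Z) := by
      simp [cyclesEdges]
    rw [h2, cyclesEdges_append_slide, hedges]
    rw [Multiset.map_add] at this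
    convert this using 1
    abel

end

/-! ### Passage to the circulant graph -/

section

open SimpleGraph

/-- The edge of a graph on `ℤ/nℤ` obtained from an edge of the strip by reduction modulo `n`. -/
def proj (n : ℕ) (e : ℕ × ℕ) : Sym2 (ZMod n) := s((e.1 : ZMod n), (e.1 : ZMod n) + e.2)

theorem proj_edge (n u v : ℕ) : proj n (edge u v) = s((u : ZMod n), (v : ZMod n)) := by
  have key : ∀ u v : ℕ, u ≤ v → proj n (edge u v) = s((u : ZMod n), (v : ZMod n)) := by
    intro u v h
    have h1 : Nat.ble u v = true := by simpa using h
    simp [proj, edge, h1, Nat.cast_sub h]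
  rcases le_total u v with h | h
  · exact key u v h
  · rw [edge_comm, key v u h, Sym2.eq_swap]

theorem proj_shift (n : ℕ) (e : ℕ × ℕ) : proj n (shift n e) = proj n e := by
  simp [proj, shift]

theorem mem_box {S : List ℕ} {p : ℕ} {e : ℕ × ℕ} : e ∈ box S p ↔ e.1 < p ∧ e.2 ∈ S := by
  obtain ⟨i, s⟩ := e
  simp only [box, List.mem_flatMap, List.mem_map, List.mem_range, Prod.mk.injEq]
  constructor
  · rintro ⟨s, hs, i, hi, rfl, rfl⟩
    exact ⟨hi, hs⟩
  · rintro ⟨hi, hs⟩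
    exact ⟨s, hs, i, hi, rfl, rfl⟩

theorem nodup_box {S : List ℕ} (hS : S.Nodup) (p : ℕ) : (box S p).Nodup := by
  unfold box
  rw [List.nodup_flatMap]
  refine ⟨fun s _ => List.nodup_range.map fun a b => by simp, ?_⟩
  refine hS.imp fun {s t} hst => ?_
  intro e he he'
  simp only [List.mem_map] at he he'
  obtain ⟨i, _, rfl⟩ := he
  obtain ⟨j, _, h⟩ := he'
  simp only [Prod.mk.injEq] at h
  exact hst h.2.symm

theorem natCast_eq_zero_of_lt {n a : ℕ} (h : ((a : ℕ) : ZMod n) = 0) (ha : a < n) : a = 0 :=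
  Nat.eq_zero_of_dvd_of_lt ((ZMod.natCast_eq_zero_iff a n).1 h) ha

theorem natCast_inj_of_lt {n a b : ℕ} (h : (a : ZMod n) = b) (hab : a < b + n) (hba : b < a + n) :
    a = b := by
  have key : ∀ a b : ℕ, (a : ZMod n) = b → b < a + n → a ≤ b → a = b := by
    intro a b h hba hle
    have := natCast_eq_zero_of_lt (n := n) (a := b - a)
      (by rw [Nat.cast_sub hle, h, sub_self]) (by omega)
    omega
  rcases le_total a b with h1 | h1
  · exact key a b h hba h1
  · exact (key b a h.symm hab h1).symm

section

variable {n : ℕ} {S : List ℕ}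

theorem proj_injOn_box (h0 : ∀ s ∈ S, 0 < s) (h1 : ∀ s ∈ S, 2 * s < n) {e f : ℕ × ℕ}
    (he : e ∈ box S n) (hf : f ∈ box S n) (h : proj n e = proj n f) : e = f := by
  obtain ⟨i, s⟩ := e
  obtain ⟨j, t⟩ := f
  rw [mem_box] at he hf
  have hs0 := h0 _ he.2
  have hs1 := h1 _ he.2
  have ht1 := h1 _ hf.2
  simp only [proj, Sym2.eq_iff] at h he hf hs0 hs1 ht1
  rcases h with ⟨h, h'⟩ | ⟨h, h'⟩
  · have hij := natCast_inj_of_lt h (by omega) (by omega)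
    rw [h, add_right_inj] at h'
    have hst := natCast_inj_of_lt h' (by omega) (by omega)
    rw [hij, hst]
  · rw [h, add_assoc, add_eq_left] at h'
    have := natCast_eq_zero_of_lt (n := n) (a := t + s) (by push_cast; exact h') (by omega)
    omega

theorem mem_edgeSet_circ [NeZero n] (h0 : ∀ s ∈ S, 0 < s) (h1 : ∀ s ∈ S, 2 * s < n)
    (e : Sym2 (ZMod n)) : e ∈ (circ n S.toFinset).edgeSet ↔ ∃ f ∈ box S n, proj n f = e := by
  induction e with | _ u v
  rw [mem_edgeSet, circ, circulantGraph_adj]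
  simp only [Set.mem_image, List.coe_toFinset, Set.mem_ofPred_eq, mem_box, proj, Sym2.eq_iff,
    Prod.exists]
  constructor
  · rintro ⟨-, ⟨s, hs, h⟩ | ⟨s, hs, h⟩⟩
    · exact ⟨v.val, s, ⟨v.val_lt, hs⟩, Or.inr ⟨by simp, by simp [h]⟩⟩
    · exact ⟨u.val, s, ⟨u.val_lt, hs⟩, Or.inl ⟨by simp, by simp [h]⟩⟩
  · rintro ⟨i, s, ⟨-, hs⟩, ⟨rfl, rfl⟩ | ⟨rfl, rfl⟩⟩ <;>
    · have hne : (s : ZMod n) ≠ 0 := fun h => by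
        have := natCast_eq_zero_of_lt h (by have := h1 s hs; omega)
        have := h0 s hs
        omega
      refine ⟨by simpa using hne, ?_⟩
      simp only [sub_add_cancel_left, add_sub_cancel_left]
      first
        | exact Or.inr ⟨s, hs, rfl⟩
        | exact Or.inl ⟨s, hs, rfl⟩

/-- Every vertex has even degree, since no element of the connection set is its own inverse. -/
theorem even_ncard_neighborSet_circ [NeZero n] (h0 : ∀ s ∈ S, 0 < s) (h1 : ∀ s ∈ S, 2 * s < n)
    (v : ZMod n) : Even ((circ n S.toFinset).neighborSet v).ncard := by
  set N : Set (ZMod n) := (fun s : ℕ => v + s) '' {s | s ∈ S} with hN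
  have hinv : Function.Injective fun w : ZMod n => v + v - w := fun a b h => by simpa using h
  have hset : (circ n S.toFinset).neighborSet v = N ∪ (fun w => v + v - w) '' N := by
    ext w
    rw [mem_neighborSet, ← mem_edgeSet, mem_edgeSet_circ h0 h1]
    simp only [mem_box, proj, Sym2.eq_iff, Prod.exists, hN, Set.mem_union, Set.mem_image,
      Set.mem_ofPred_eq, exists_exists_and_eq_and]
    constructor
    · rintro ⟨i, s, ⟨-, hs⟩, ⟨rfl, rfl⟩ | ⟨rfl, rfl⟩⟩
      · exact Or.inl ⟨s, hs, rfl⟩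
      · exact Or.inr ⟨s, hs, by ring⟩
    · rintro (⟨s, hs, rfl⟩ | ⟨s, hs, rfl⟩)
      · exact ⟨v.val, s, ⟨v.val_lt, hs⟩, Or.inl ⟨by simp, by simp⟩⟩
      · exact ⟨(v - s).val, s, ⟨ZMod.val_lt _, hs⟩, Or.inr ⟨by simp, by simp⟩⟩
  have hdisj : Disjoint N ((fun w => v + v - w) '' N) := by
    rw [Set.disjoint_left]
    rintro _ ⟨s, hs, rfl⟩ ⟨_, ⟨t, ht, rfl⟩, h⟩
    have := natCast_eq_zero_of_lt (n := n) (a := s + t) (by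
      push_cast
      linear_combination -h) (by have := h1 s hs; have := h1 t ht; omega)
    have := h0 s hs
    omega
  rw [hset, Set.ncard_union_eq hdisj (Set.toFinite _) (Set.toFinite _),
    Set.ncard_image_of_injective _ hinv]
  exact ⟨_, rfl⟩

/-- A list of vertices of the strip whose consecutive edges project into a graph gives a walk. -/
theorem exists_walk (G : SimpleGraph (ZMod n)) (u : ℕ) (l : List ℕ) (z : ℕ)
    (h : ∀ e ∈ pathEdges (u :: (l ++ [z])), proj n e ∈ G.edgeSet) :
    ∃ w : G.Walk (u : ZMod n) (z : ZMod n),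
      w.support = (u :: (l ++ [z])).map (fun v : ℕ => (v : ZMod n)) ∧
      w.edges = (pathEdges (u :: (l ++ [z]))).map (proj n) := by
  induction l generalizing u with
  | nil =>
    have ha : G.Adj (u : ZMod n) z := by
      have := h (edge u z) (by simp [pathEdges])
      rwa [proj_edge] at this
    exact ⟨.cons ha .nil, by simp, by simp [pathEdges, proj_edge]⟩
  | cons v l ih =>
    obtain ⟨w, hw, hw'⟩ := ih v fun e he => h e (by simp [pathEdges] at he ⊢; exact Or.inr he)
    have ha : G.Adj (u : ZMod n) v := by
      have := h (edge u v) (by simp [pathEdges])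
      rwa [proj_edge] at this
    exact ⟨.cons ha w, by simp [hw], by simp [pathEdges, proj_edge, hw']⟩

/-- A narrow cycle of the strip whose edges project to distinct edges of a graph on `ℤ/nℤ` gives a
cycle in that graph. -/
theorem exists_cycle (G : SimpleGraph (ZMod n)) {c : List ℕ} (hc : Narrow n c) (h2 : 2 ≤ c.length)
    (hG : ∀ e ∈ cycleEdges c, proj n e ∈ G.edgeSet) (hnd : ((cycleEdges c).map (proj n)).Nodup) :
    ∃ H : G.Subgraph, IsCycleOfLength H c.length ∧
      ∀ e, e ∈ H.edgeSet ↔ e ∈ (cycleEdges c).map (proj n) := by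
  obtain ⟨u, v, l, rfl⟩ : ∃ u v l, c = u :: v :: l := by
    match c, h2 with
    | u :: v :: l, _ => exact ⟨u, v, l, rfl⟩
  obtain ⟨w, hw, hw'⟩ := exists_walk G v l u fun e he => hG e (by
    simp only [cycleEdges, List.cons_append, pathEdges]
    exact List.mem_cons_of_mem _ he)
  have ha : G.Adj (u : ZMod n) v := by
    have := hG (edge u v) (by simp [cycleEdges, pathEdges])
    rwa [proj_edge] at this
  have hedges : (Walk.cons ha w).edges = (cycleEdges (u :: v :: l)).map (proj n) := by
    simp [cycleEdges, pathEdges, proj_edge, hw']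
  have hpath : w.IsPath := by
    rw [Walk.isPath_def, hw]
    refine List.Nodup.map_on ?_ ?_
    · intro a ha b hb hab
      have hmem : ∀ a, a ∈ v :: (l ++ [u]) → a ∈ u :: v :: l := by
        intro a ha
        simp only [List.mem_cons, List.mem_append, List.not_mem_nil, or_false] at ha ⊢
        tauto
      exact natCast_inj_of_lt hab (hc.2 a (hmem a ha) b (hmem b hb))
        (hc.2 b (hmem b hb) a (hmem a ha))
    · refine (List.Perm.nodup_iff ?_).1 hc.1
      exact (List.perm_append_singleton u (v :: l)).symm
  have hcyc : (Walk.cons ha w).IsCycle := by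
    rw [Walk.cons_isCycle_iff]
    refine ⟨hpath, ?_⟩
    rw [← hedges, Walk.edges_cons, List.nodup_cons] at hnd
    exact hnd.1
  refine ⟨(Walk.cons ha w).toSubgraph, ⟨_, _, hcyc, ?_, rfl⟩, fun e => ?_⟩
  · have := congrArg List.length hw
    rw [Walk.length_support] at this
    simp at this
    simp [this]
  · rw [Walk.edgeSet_toSubgraph, ← hedges]
    rfl

end

theorem exists_perm_map_eq {α β : Type*} (f : α → β) {l : List α} {m : List β}
    (h : (l.map f).Perm m) : ∃ l' : List α, l'.Perm l ∧ l'.map f = m := by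
  have h1 : List.Forall₂ (fun y x => f x = y) (l.map f) l := by
    rw [List.forall₂_map_left_iff]
    exact List.forall₂_same.2 fun _ _ => rfl
  obtain ⟨l', h2, h3⟩ := List.perm_comp_forall₂ h.symm h1
  refine ⟨l', h3, ?_⟩
  clear h1 h3 h
  induction h2 with
  | nil => rfl
  | cons h _ ih => simp [h, ih]

/-- A decomposition of `n` columns of the strip wraps around to a decomposition of the circulant
graph on `ℤ/nℤ`: modulo `n` the two staircases cancel, so that every edge is used exactly once. -/
theorem Closed.hasDecomposition {F : Frame} {n : ℕ} [NeZero n] {M : List ℕ}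
    (hS : (F.A.map Prod.fst).Nodup) (h0 : ∀ s ∈ F.A.map Prod.fst, 0 < s)
    (h1 : ∀ s ∈ F.A.map Prod.fst, 2 * s < n) (hM : ∀ m ∈ M, 2 ≤ m) (h : Closed F n n M) :
    HasDecomposition (circ n (F.A.map Prod.fst).toFinset) M := by
  set S := F.A.map Prod.fst with hSdef
  obtain ⟨C₀, hC₀, hn₀, hf₀⟩ := h
  obtain ⟨C, hCperm, rfl⟩ := exists_perm_map_eq List.length (Multiset.coe_eq_coe.1 hC₀)
  have hn : ∀ c ∈ C, Narrow n c := fun c hc => hn₀ c (hCperm.mem_iff.1 hc)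
  have hf : Fills F.A F.A n (cyclesEdges C) := by
    rwa [Multiset.coe_eq_coe.2 (show (cyclesEdges C).Perm (cyclesEdges C₀) from
      hCperm.flatMap_right _)]
  have hproj : ((cyclesEdges C).map (proj n)).Perm ((box S n).map (proj n)) := by
    rw [← Multiset.coe_eq_coe]
    have h2 := congrArg (Multiset.map (proj n)) hf
    have h3 := Multiset.coe_eq_coe.2 (fill_add F.A n 0)
    rw [Nat.add_zero] at h3
    rw [h3, ← Multiset.coe_add, Multiset.map_add, Multiset.map_add, Multiset.map_coe,
      Multiset.map_coe, Multiset.map_coe, Multiset.map_coe, List.map_map,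
      show proj n ∘ shift n = proj n from funext (proj_shift n)] at h2
    exact add_right_cancel h2
  have hnd : ((cyclesEdges C).map (proj n)).Nodup := by
    rw [hproj.nodup_iff]
    exact (nodup_box hS n).map_on fun e he f hf h => proj_injOn_box h0 h1 he hf h
  have hmem : ∀ e, e ∈ (cyclesEdges C).map (proj n) ↔ e ∈ (circ n S.toFinset).edgeSet := by
    intro e
    rw [hproj.mem_iff, mem_edgeSet_circ h0 h1]
    simp
  rw [cyclesEdges, List.map_flatMap] at hnd hmem
  rw [List.nodup_flatMap] at hnd
  have hex : ∀ i : Fin (C.map List.length).length, ∃ H : (circ n S.toFinset).Subgraph,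
      IsCycleOfLength H ((C.map List.length).get i) ∧
        ∀ e, e ∈ H.edgeSet ↔ e ∈ (cycleEdges (C.get (i.cast (by simp)))).map (proj n) := by
    intro i
    have hc : C.get (i.cast (by simp)) ∈ C := List.get_mem _ _
    have := exists_cycle (circ n S.toFinset) (hn _ hc) (hM _ (List.mem_map_of_mem hc))
      (fun e he => (hmem _).1 (List.mem_flatMap.2 ⟨_, hc, List.mem_map_of_mem he⟩)) (hnd.1 _ hc)
    simpa using this
  choose G hG hG' using hex
  refine Or.inl ⟨even_ncard_neighborSet_circ h0 h1, G, hG, ?_, ?_⟩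
  · intro i j hij
    rw [Set.disjoint_left]
    intro e he he'
    rw [hG'] at he he'
    have key : ∀ i j : Fin (C.map List.length).length, i < j →
        e ∈ (cycleEdges (C.get (i.cast (by simp)))).map (proj n) →
        e ∈ (cycleEdges (C.get (j.cast (by simp)))).map (proj n) → False := by
      intro i j hij he he'
      exact List.pairwise_iff_get.1 hnd.2 _ _ hij he he'
    rcases lt_or_gt_of_ne hij with h | h
    · exact key i j h he he'
    · exact key j i h he' he
  · ext e
    rw [← hmem, Set.mem_iUnion, List.mem_flatMap]
    constructor
    · rintro ⟨i, hi⟩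
      exact ⟨_, List.get_mem _ _, (hG' i e).1 hi⟩
    · rintro ⟨c, hc, he⟩
      obtain ⟨j, rfl⟩ := List.get_of_mem hc
      exact ⟨j.cast (by simp), (hG' _ e).2 he⟩

end

/-! ### Explicit segments and their verification -/

section

/-- The numerical type of a segment: the number `l` of columns, the number `k` of edges of the long
cycle, and the numbers `a`, `b`, `c` of cycles with lengths `3`, `4`, `5`. -/
structure Kind where
  l : ℕ
  k : ℕ
  a : ℕ
  b : ℕ
  c : ℕ

/-- The multiset consisting of `a` threes, `b` fours and `c` fives. -/
def short (a b c : ℕ) : Multiset ℕ :=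
  (List.replicate a 3 ++ List.replicate b 4 ++ List.replicate c 5 : List ℕ)

theorem short_eq (a b c : ℕ) : short a b c =
    Multiset.replicate a 3 + Multiset.replicate b 4 + Multiset.replicate c 5 := by
  simp [short, ← Multiset.coe_add, Multiset.coe_replicate, add_assoc]

theorem short_add (a b c a' b' c' : ℕ) :
    short a b c + short a' b' c' = short (a + a') (b + b') (c + c') := by
  simp only [short_eq, Multiset.replicate_add]
  abel

/-- Removal of one copy of `e` from a list of edges. -/
def eraseEdge (e : ℕ × ℕ) : List (ℕ × ℕ) → Option (List (ℕ × ℕ))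
  | [] => none
  | f :: l => bif Nat.beq e.1 f.1 && Nat.beq e.2 f.2 then some l else (eraseEdge e l).map (f :: ·)

/-- A test whether two lists of edges agree up to order. -/
def samePerm : List (ℕ × ℕ) → List (ℕ × ℕ) → Bool
  | [], m => m.isEmpty
  | e :: l, m =>
    match eraseEdge e m with
    | none => false
    | some m' => samePerm l m'

theorem perm_of_eraseEdge {e : ℕ × ℕ} {l m : List (ℕ × ℕ)} (h : eraseEdge e l = some m) :
    l.Perm (e :: m) := by
  induction l generalizing m with
  | nil => simp [eraseEdge] at h
  | cons f l ih =>
    rw [eraseEdge] at h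
    cases hb : (Nat.beq e.1 f.1 && Nat.beq e.2 f.2) with
    | true =>
      simp only [hb, cond_true, Option.some.injEq] at h
      simp only [Bool.and_eq_true, Nat.beq_eq] at hb
      rw [h, Prod.ext hb.1 hb.2]
    | false =>
      simp only [hb, cond_false, Option.map_eq_some_iff] at h
      obtain ⟨m', hm, rfl⟩ := h
      exact ((ih hm).cons f).trans (List.Perm.swap _ _ _)

theorem perm_of_samePerm {l m : List (ℕ × ℕ)} (h : samePerm l m = true) : l.Perm m := by
  induction l generalizing m with
  | nil =>
    rw [samePerm, List.isEmpty_iff] at h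
    rw [h]
  | cons e l ih =>
    rw [samePerm] at h
    split at h
    · simp at h
    · next m' hm => exact ((ih h).cons e).trans (perm_of_eraseEdge hm).symm

/-- A test for `Fills`. -/
def fillsTest (D₁ D₂ : List (ℕ × ℕ)) (l : ℕ) (E : List (ℕ × ℕ)) : Bool :=
  samePerm (E ++ fill D₁ 0) (fill D₂ l)

theorem fills_of_test {D₁ D₂ : List (ℕ × ℕ)} {l : ℕ} {E : List (ℕ × ℕ)}
    (h : fillsTest D₁ D₂ l E = true) : Fills D₁ D₂ l E :=
  Multiset.coe_eq_coe.2 (perm_of_samePerm h)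

/-- A test that the lengths of the cycles `C` are listed by `M` and that all cycles are narrow. -/
def cyclesTest (d : ℕ) (M : List ℕ) (C : List (List ℕ)) : Bool :=
  decide (C.map List.length = M) &&
    C.all fun c => decide c.Nodup && c.all fun u => c.all fun v => Nat.blt u (v + d)

theorem cycles_of_test {d d' : ℕ} (hd : d ≤ d') {M : List ℕ} {C : List (List ℕ)}
    (h : cyclesTest d M C = true) : lengths C = M ∧ ∀ c ∈ C, Narrow d' c := by
  simp only [cyclesTest, Bool.and_eq_true, decide_eq_true_eq, List.all_eq_true] at h
  refine ⟨by rw [lengths, h.1], fun c hc => ⟨(h.2 c hc).1, fun u hu v hv => ?_⟩⟩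
  have := (h.2 c hc).2 u hu v hv
  rw [Nat.blt_eq] at this
  omega

/-- The cycle lengths of a kind of segment. -/
def Kind.list (t : Kind) : List ℕ :=
  List.replicate t.a 3 ++ List.replicate t.b 4 ++ List.replicate t.c 5

/-- An explicit segment: its cycles and the at most two strands of its long cycle. -/
structure Piece where
  C : List (List ℕ)
  X : List ℕ
  Y : List ℕ

/-- A test for closed segments of kind `t`. -/
def closedTest (F : Frame) (d : ℕ) (t : Kind) (C : List (List ℕ)) : Bool :=
  Nat.blt 0 t.l && cyclesTest d t.list C && fillsTest F.A F.A t.l (cyclesEdges C)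

/-- A test for opening segments of kind `t`; the path is the first strand. -/
def openTest (F : Frame) (d : ℕ) (t : Kind) (p : Piece) : Bool :=
  cyclesTest d t.list p.C && decide p.X.Nodup &&
    (p.X.all fun v => Nat.ble F.lo v && Nat.blt v (t.l + F.hi)) &&
    decide (p.X.head? = some (t.l + F.x)) && decide (p.X.getLast? = some (t.l + F.y)) &&
    Nat.beq p.X.length (t.k + 1) && fillsTest F.A F.B t.l (cyclesEdges p.C ++ pathEdges p.X)

/-- A test for passing segments of kind `t`. -/
def passTest (F : Frame) (d : ℕ) (t : Kind) (p : Piece) : Bool :=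
  Nat.blt 0 t.l && Nat.beq t.k t.l && cyclesTest d t.list p.C && decide (p.X ++ p.Y).Nodup &&
    ((p.X ++ p.Y).all fun v => Nat.ble F.hi v && Nat.blt v (t.l + F.hi)) &&
    (decide (p.X.getLastD F.x = t.l + F.x ∧ p.Y.getLastD F.y = t.l + F.y) ||
      decide (p.X.getLastD F.x = t.l + F.y ∧ p.Y.getLastD F.y = t.l + F.x)) &&
    Nat.beq (p.X.length + p.Y.length) t.k &&
    fillsTest F.B F.B t.l (cyclesEdges p.C ++ (pathEdges (F.x :: p.X) ++ pathEdges (F.y :: p.Y)))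

/-- A test for closing segments of kind `t`; the interior of the path is the first strand. -/
def closeTest (F : Frame) (d : ℕ) (t : Kind) (p : Piece) : Bool :=
  Nat.ble F.hi (t.l + F.lo) && cyclesTest d t.list p.C && decide p.X.Nodup &&
    (p.X.all fun v => Nat.ble F.hi v && Nat.blt v (t.l + F.lo)) && Nat.beq (p.X.length + 1) t.k &&
    fillsTest F.B F.A t.l (cyclesEdges p.C ++ pathEdges (F.y :: (p.X ++ [F.x])))

variable {F : Frame} {d d' : ℕ} {t : Kind} {p : Piece}

theorem closed_of_test (hd : d ≤ d') {C : List (List ℕ)} (h : closedTest F d t C = true) :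
    0 < t.l ∧ Closed F d' t.l (short t.a t.b t.c) := by
  simp only [closedTest, Bool.and_eq_true, Nat.blt_eq] at h
  obtain ⟨⟨h0, h1⟩, h2⟩ := h
  obtain ⟨h3, h4⟩ := cycles_of_test hd h1
  exact ⟨h0, C, h3, h4, fills_of_test h2⟩

theorem opening_of_test (hd : d ≤ d') (h : openTest F d t p = true) :
    Opening F d' t.l t.k (short t.a t.b t.c) := by
  simp only [openTest, Bool.and_eq_true, decide_eq_true_eq, List.all_eq_true, Nat.blt_eq,
    Nat.ble_eq, Nat.beq_eq] at h
  obtain ⟨⟨⟨⟨⟨⟨h1, h2⟩, h3⟩, h4⟩, h5⟩, h6⟩, h7⟩ := h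
  obtain ⟨h8, h9⟩ := cycles_of_test hd h1
  exact ⟨p.C, p.X, h8, h9, h2, h3, h4, h5, h6, by rw [Multiset.coe_add]; exact fills_of_test h7⟩

theorem passing_of_test (hd : d ≤ d') (h : passTest F d t p = true) :
    0 < t.l ∧ t.k = t.l ∧ Passing F d' t.l t.k (short t.a t.b t.c) := by
  simp only [passTest, Bool.and_eq_true, Bool.or_eq_true, decide_eq_true_eq, List.all_eq_true,
    Nat.blt_eq, Nat.ble_eq, Nat.beq_eq] at h
  obtain ⟨⟨⟨⟨⟨⟨⟨h0, h0'⟩, h1⟩, h2⟩, h3⟩, h4⟩, h5⟩, h6⟩ := h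
  obtain ⟨h8, h9⟩ := cycles_of_test hd h1
  refine ⟨h0, h0', p.C, p.X, p.Y, h8, h9, h2, h3, h4, h5, ?_⟩
  rw [Multiset.coe_add, Multiset.coe_add]
  exact fills_of_test h6

theorem closing_of_test (hd : d ≤ d') (h : closeTest F d t p = true) :
    Closing F d' t.l t.k (short t.a t.b t.c) := by
  simp only [closeTest, Bool.and_eq_true, decide_eq_true_eq, List.all_eq_true, Nat.blt_eq,
    Nat.ble_eq, Nat.beq_eq] at h
  obtain ⟨⟨⟨⟨⟨h0, h1⟩, h2⟩, h3⟩, h4⟩, h5⟩ := h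
  obtain ⟨h8, h9⟩ := cycles_of_test hd h1
  refine ⟨h0, p.C, p.X, h8, h9, h2, h3, h4, ?_⟩
  rw [Multiset.coe_add]
  exact fills_of_test h5

/-- A test that two lists correspond to each other entry by entry. -/
def matchTest {α β : Type} (f : α → β → Bool) : List α → List β → Bool
  | [], [] => true
  | a :: l, b :: m => f a b && matchTest f l m
  | _, _ => false

theorem exists_of_matchTest {α β : Type} {f : α → β → Bool} {l : List α} {m : List β}
    (h : matchTest f l m = true) : ∀ a ∈ l, ∃ b, f a b = true := by
  induction l generalizing m with
  | nil => simp
  | cons a l ih =>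
    cases m with
    | nil => simp [matchTest] at h
    | cons b m =>
      simp only [matchTest, Bool.and_eq_true] at h
      intro a' ha'
      rcases List.mem_cons.1 ha' with rfl | ha'
      · exact ⟨b, h.1⟩
      · exact ih h.2 a' ha'

end

/-! ### Reduction of lists of cycle lengths -/

/-- A test of `p` for all numbers below `n`. -/
def allBelow : ℕ → (ℕ → Bool) → Bool
  | 0, _ => true
  | n + 1, p => p n && allBelow n p

theorem of_allBelow {n : ℕ} {p : ℕ → Bool} (h : allBelow n p = true) {i : ℕ} (hi : i < n) :
    p i = true := by
  induction n with
  | zero => omega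
  | succ n ih =>
    simp only [allBelow, Bool.and_eq_true] at h
    rcases Nat.lt_succ_iff_lt_or_eq.1 hi with hi | rfl
    · exact ih h.2 hi
    · exact h.1

/-- The lists that admit no decomposition: for five differences, all triangles when `n ≡ 3` modulo
`6`, and triangles with one pentagon when `n ≡ 4` modulo `6`. -/
def exceptional (N n b c : ℕ) : Bool :=
  Nat.beq N 5 && Nat.beq b 0 &&
    ((Nat.beq c 0 && Nat.beq (n % 6) 3) || (Nat.beq c 1 && Nat.beq (n % 6) 4))

/-- The lists with one hexagon and otherwise triangles, for five differences and `n ≡ 3` modulo `6`;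
these are decomposed separately. -/
def hexagonal (N n k b c : ℕ) : Bool :=
  Nat.beq N 5 && Nat.beq k 6 && Nat.beq b 0 && Nat.beq c 0 && Nat.beq (n % 6) 3

theorem exceptional_eq_false {N n b c : ℕ} : exceptional N n b c = false ↔
    ¬(N = 5 ∧ b = 0 ∧ (c = 0 ∧ n % 6 = 3 ∨ c = 1 ∧ n % 6 = 4)) := by
  rw [← Bool.not_eq_true]
  simp [exceptional, and_assoc]

theorem hexagonal_eq_false {N n k b c : ℕ} : hexagonal N n k b c = false ↔
    ¬(N = 5 ∧ k = 6 ∧ b = 0 ∧ c = 0 ∧ n % 6 = 3) := by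
  rw [← Bool.not_eq_true]
  simp [hexagonal, and_assoc]

/-- Membership of `(n, b, c)` in a table of lists left out; `b` and `c` are packed into one
number. -/
def omitted₀ (N : ℕ) (T : List (List ℕ)) (n b c : ℕ) : Bool :=
  exceptional N n b c || (T.getD n []).any (Nat.beq (100 * b + c))

/-- Membership of `(n, k, b, c)` in a table of lists left out, whose rows start with `k = 6`. -/
def omitted (N : ℕ) (T : List (List (List ℕ))) (n k b c : ℕ) : Bool :=
  hexagonal N n k b c || ((T.getD n []).getD (k - 6) []).any (Nat.beq (100 * b + c))

/-- A list with `a` threes, `b` fours and `c` fives contains the cycles of a segment. -/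
def Kind.fits (f : Kind) (a b c : ℕ) : Bool := Nat.ble f.a a && Nat.ble f.b b && Nat.ble f.c c

/-- Every list of threes, fours and fives for `n < nb` columns that is not left out becomes one that
is not left out after the removal of a closed segment. -/
def coverTest₀ (N nb : ℕ) (T : List (List ℕ)) (A : List Kind) : Bool :=
  allBelow nb fun n => Nat.beq n 0 ||
    allBelow (N * n / 4 + 1) fun b => allBelow ((N * n - 4 * b) / 5 + 1) fun c =>
      !Nat.beq ((N * n - 4 * b - 5 * c) % 3) 0 || omitted₀ N T n b c ||
        A.any fun f => f.fits ((N * n - 4 * b - 5 * c) / 3) b c && Nat.ble f.l n &&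
          !omitted₀ N T (n - f.l) (b - f.b) (c - f.c)

/-- Every list for `n < nb` columns with a cycle of length `k ≥ 6` that is not left out either is
realized by an opening and a closing segment, or becomes one that is not left out after the removal
of a closed or a passing segment. -/
def coverTest (N nb : ℕ) (T : List (List (List ℕ))) (A B L R : List Kind) : Bool :=
  allBelow nb fun n => allBelow (n + 1) fun k => Nat.ble k 5 ||
    allBelow ((N * n - k) / 4 + 1) fun b => allBelow ((N * n - k - 4 * b) / 5 + 1) fun c =>
      !Nat.beq ((N * n - k - 4 * b - 5 * c) % 3) 0 || omitted N T n k b c ||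
        (A.any fun f => f.fits ((N * n - k - 4 * b - 5 * c) / 3) b c && Nat.ble (k + f.l) n &&
          !omitted N T (n - f.l) k (b - f.b) (c - f.c)) ||
        (B.any fun f => f.fits ((N * n - k - 4 * b - 5 * c) / 3) b c && Nat.ble (6 + f.l) k &&
          !omitted N T (n - f.l) (k - f.l) (b - f.b) (c - f.c)) ||
        L.any fun f => f.fits ((N * n - k - 4 * b - 5 * c) / 3) b c &&
          R.any fun g => Nat.beq (f.b + g.b) b && Nat.beq (f.c + g.c) c && Nat.beq (f.l + g.l) n &&
            Nat.beq (f.k + g.k) k && Nat.beq (f.a + g.a) ((N * n - k - 4 * b - 5 * c) / 3)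

theorem Kind.of_fits {f : Kind} {a b c : ℕ} (h : f.fits a b c = true) :
    f.a ≤ a ∧ f.b ≤ b ∧ f.c ≤ c := by
  simpa [Kind.fits, and_assoc] using h

variable {N nb : ℕ} {A B L R : List Kind}

theorem of_coverTest₀ {T : List (List ℕ)} (h : coverTest₀ N nb T A = true)
    {P : ℕ → ℕ → ℕ → ℕ → Prop} (hzero : P 0 0 0 0)
    (hA : ∀ f ∈ A, 0 < f.l ∧ 3 * f.a + 4 * f.b + 5 * f.c = N * f.l ∧
      ∀ n a b c, P n a b c → P (n + f.l) (a + f.a) (b + f.b) (c + f.c))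
    {n a b c : ℕ} (hn : n < nb) (hs : 3 * a + 4 * b + 5 * c = N * n)
    (ho : omitted₀ N T n b c = false) : P n a b c := by
  induction n using Nat.strong_induction_on generalizing a b c with | _ n ih
  have h1 := of_allBelow h hn
  rcases Nat.eq_zero_or_pos n with rfl | hpos
  · obtain ⟨rfl, rfl, rfl⟩ : a = 0 ∧ b = 0 ∧ c = 0 := by simpa [and_assoc] using hs
    exact hzero
  have hn0 : Nat.beq n 0 = false := by rw [← Bool.not_eq_true, Nat.beq_eq]; omega
  rw [hn0, Bool.false_or] at h1
  have ha : (N * n - 4 * b - 5 * c) / 3 = a := by omega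
  have hm : Nat.beq ((N * n - 4 * b - 5 * c) % 3) 0 = true := by simp; omega
  have h2 := of_allBelow (of_allBelow h1 (i := b) (by omega)) (i := c) (by omega)
  rw [ha, hm, ho] at h2
  simp only [Bool.not_true, Bool.false_or, List.any_eq_true, Bool.and_eq_true, Nat.ble_eq,
    Bool.not_eq_true'] at h2
  obtain ⟨f, hf, ⟨hfit, hl⟩, hom⟩ := h2
  obtain ⟨h3, h4, h5⟩ := Kind.of_fits hfit
  obtain ⟨hl0, hfs, hstep⟩ := hA f hf
  have := hstep (n - f.l) (a - f.a) (b - f.b) (c - f.c) (ih _ (by omega) (by omega)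
    (by rw [Nat.mul_sub N]; omega) hom)
  simpa only [Nat.sub_add_cancel, h3, h4, h5, hl] using this

theorem of_coverTest {T : List (List (List ℕ))} (h : coverTest N nb T A B L R = true)
    {P : ℕ → ℕ → ℕ → ℕ → ℕ → Prop}
    (hA : ∀ f ∈ A, 0 < f.l ∧ 3 * f.a + 4 * f.b + 5 * f.c = N * f.l ∧
      ∀ n k a b c, P n k a b c → P (n + f.l) k (a + f.a) (b + f.b) (c + f.c))
    (hB : ∀ f ∈ B, 0 < f.l ∧ 3 * f.a + 4 * f.b + 5 * f.c + f.l = N * f.l ∧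
      ∀ n k a b c, P n k a b c → P (n + f.l) (k + f.l) (a + f.a) (b + f.b) (c + f.c))
    (hLR : ∀ f ∈ L, ∀ g ∈ R, P (f.l + g.l) (f.k + g.k) (f.a + g.a) (f.b + g.b) (f.c + g.c))
    {n k a b c : ℕ} (hn : n < nb) (hk : 6 ≤ k) (hkn : k ≤ n)
    (hs : 3 * a + 4 * b + 5 * c + k = N * n) (ho : omitted N T n k b c = false) :
    P n k a b c := by
  induction n using Nat.strong_induction_on generalizing k a b c with | _ n ih
  have h1 := of_allBelow (of_allBelow h hn) (i := k) (by omega)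
  have hk5 : Nat.ble k 5 = false := by rw [← Bool.not_eq_true, Nat.ble_eq]; omega
  rw [hk5, Bool.false_or] at h1
  have ha : (N * n - k - 4 * b - 5 * c) / 3 = a := by omega
  have hm : Nat.beq ((N * n - k - 4 * b - 5 * c) % 3) 0 = true := by simp; omega
  have h2 := of_allBelow (of_allBelow h1 (i := b) (by omega)) (i := c) (by omega)
  rw [ha, hm, ho] at h2
  simp only [Bool.not_true, Bool.false_or, Bool.or_eq_true, List.any_eq_true, Bool.and_eq_true,
    Nat.ble_eq, Nat.beq_eq, Bool.not_eq_true'] at h2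
  rcases h2 with (⟨f, hf, ⟨hfit, hl⟩, hom⟩ | ⟨f, hf, ⟨hfit, hl⟩, hom⟩) | ⟨f, hf, -, g, hg, he⟩
  · obtain ⟨h3, h4, h5⟩ := Kind.of_fits hfit
    obtain ⟨hl0, hfs, hstep⟩ := hA f hf
    have hl' : f.l ≤ n := by omega
    have := hstep (n - f.l) k (a - f.a) (b - f.b) (c - f.c) (ih _ (by omega) (by omega) hk
      (by omega) (by rw [Nat.mul_sub N]; omega) hom)
    simpa only [Nat.sub_add_cancel, h3, h4, h5, hl'] using this
  · obtain ⟨h3, h4, h5⟩ := Kind.of_fits hfit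
    obtain ⟨hl0, hfs, hstep⟩ := hB f hf
    have hl' : f.l ≤ n := by omega
    have hk' : f.l ≤ k := by omega
    have := hstep (n - f.l) (k - f.l) (a - f.a) (b - f.b) (c - f.c) (ih _ (by omega) (by omega)
      (by omega) (by omega) (by rw [Nat.mul_sub N]; omega) hom)
    simpa only [Nat.sub_add_cancel, h3, h4, h5, hl', hk'] using this
  · obtain ⟨⟨⟨⟨rfl, rfl⟩, rfl⟩, rfl⟩, rfl⟩ := he
    exact hLR f hf g hg

/-- For many columns one of the numbers of threes, fours and fives is so large that cycles of this
one length fill some closed segment, so the number of columns can be reduced. -/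
theorem extend_cover₀ {P : ℕ → ℕ → ℕ → ℕ → Prop} {n₀ : ℕ} (hN : 3 ≤ N ∧ N ≤ 8)
    (hbase : ∀ n a b c, n₀ ≤ n → n < n₀ + 6 → 3 * a + 4 * b + 5 * c = N * n →
      exceptional N n b c = false → P n a b c) (h9 : 9 ≤ n₀)
    (h3 : ∀ n a b c, P n a b c → P (n + 6) (a + 2 * N) b c)
    (h4 : ∀ n a b c, P n a b c → P (n + 4) a (b + N) c)
    (h5 : ∀ n a b c, P n a b c → P (n + 5) a b (c + N))
    {n a b c : ℕ} (hn : n₀ ≤ n) (hs : 3 * a + 4 * b + 5 * c = N * n)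
    (he : exceptional N n b c = false) : P n a b c := by
  induction n using Nat.strong_induction_on generalizing a b c with | _ n ih
  by_cases hlt : n < n₀ + 6
  · exact hbase n a b c hn hlt hs he
  simp only [exceptional_eq_false] at he ih
  obtain ⟨hN3, hN8⟩ := hN
  by_cases ha : 2 * N ≤ a
  · have := h3 (n - 6) (a - 2 * N) b c (ih _ (by omega) (by omega)
      (by rw [Nat.mul_sub N]; omega) (by omega))
    simpa only [Nat.sub_add_cancel, ha, show 6 ≤ n by omega] using this
  -- an exceptional list would consist of too few threes and at most one five
  by_cases hb : N ≤ b
  · have := h4 (n - 4) a (b - N) c (ih _ (by omega) (by omega)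
      (by rw [Nat.mul_sub N]; omega) (by interval_cases N <;> omega))
    simpa only [Nat.sub_add_cancel, hb, show 4 ≤ n by omega] using this
  by_cases hc : N ≤ c
  · have := h5 (n - 5) a b (c - N) (ih _ (by omega) (by omega)
      (by rw [Nat.mul_sub N]; omega) (by interval_cases N <;> omega))
    simpa only [Nat.sub_add_cancel, hc, show 5 ≤ n by omega] using this
  -- otherwise the sum is at most `3 * (2 * N - 1) + 4 * (N - 1) + 5 * (N - 1) < 15 * N`
  exfalso
  interval_cases N <;> omega

/-- The analogue of `extend_cover₀` in the presence of a long cycle: a closed segment is removed if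
enough columns remain for the long cycle, and otherwise a passing segment. -/
theorem extend_cover {P : ℕ → ℕ → ℕ → ℕ → ℕ → Prop} {n₀ n₁ : ℕ} (hN : 3 ≤ N ∧ N ≤ 8)
    (hn₁ : 16 ≤ n₁ ∧ n₀ + 5 ≤ n₁)
    (hbase : ∀ n k a b c, n₀ ≤ n → n ≤ n₁ → 6 ≤ k → k ≤ n → 3 * a + 4 * b + 5 * c + k = N * n →
      hexagonal N n k b c = false → P n k a b c)
    (hA3 : ∀ n k a b c, P n k a b c → P (n + 6) k (a + 2 * N) b c)
    (hA4 : ∀ n k a b c, P n k a b c → P (n + 4) k a (b + N) c)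
    (hA5 : ∀ n k a b c, P n k a b c → P (n + 5) k a b (c + N))
    (hB3 : ∀ n k a b c, P n k a b c → P (n + 6) (k + 6) (a + (2 * N - 2)) b c)
    (hB4 : ∀ n k a b c, P n k a b c → P (n + 4) (k + 4) a (b + (N - 1)) c)
    (hB5 : ∀ n k a b c, P n k a b c → P (n + 5) (k + 5) a b (c + (N - 1)))
    {n k a b c : ℕ} (hn : n₀ ≤ n) (hk : 6 ≤ k) (hkn : k ≤ n)
    (hs : 3 * a + 4 * b + 5 * c + k = N * n)
    (he : hexagonal N n k b c = false) : P n k a b c := by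
  induction n using Nat.strong_induction_on generalizing k a b c with | _ n ih
  by_cases hlt : n ≤ n₁
  · exact hbase n k a b c hn hlt hk hkn hs he
  simp only [hexagonal_eq_false] at he ih
  obtain ⟨hN3, hN8⟩ := hN
  by_cases ha : 2 * N ≤ a
  · by_cases hk6 : k + 6 ≤ n
    · have := hA3 (n - 6) k (a - 2 * N) b c (ih _ (by omega) (by omega) hk (by omega)
        (by rw [Nat.mul_sub N]; omega) (by omega))
      simpa only [Nat.sub_add_cancel, ha, show 6 ≤ n by omega] using this
    -- a hexagonal list would require `k = 12`, hence `n = 17`, which is not `3` modulo `6`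
    · have := hB3 (n - 6) (k - 6) (a - (2 * N - 2)) b c (ih _ (by omega) (by omega) (by omega)
        (by omega) (by rw [Nat.mul_sub N]; omega) (by omega))
      simpa only [Nat.sub_add_cancel, show 2 * N - 2 ≤ a by omega, show 6 ≤ n by omega,
        show 6 ≤ k by omega] using this
  -- a hexagonal list would contain more threes than remain
  by_cases hb : N ≤ b
  · by_cases hk6 : k + 4 ≤ n
    · have := hA4 (n - 4) k a (b - N) c (ih _ (by omega) (by omega) hk (by omega)
        (by rw [Nat.mul_sub N]; omega) (by interval_cases N <;> omega))
      simpa only [Nat.sub_add_cancel, hb, show 4 ≤ n by omega] using this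
    · have := hB4 (n - 4) (k - 4) a (b - (N - 1)) c (ih _ (by omega) (by omega) (by omega)
        (by omega) (by rw [Nat.mul_sub N]; omega) (by omega))
      simpa only [Nat.sub_add_cancel, show N - 1 ≤ b by omega, show 4 ≤ n by omega,
        show 4 ≤ k by omega] using this
  by_cases hc : N ≤ c
  · by_cases hk6 : k + 5 ≤ n
    · have := hA5 (n - 5) k a b (c - N) (ih _ (by omega) (by omega) hk (by omega)
        (by rw [Nat.mul_sub N]; omega) (by interval_cases N <;> omega))
      simpa only [Nat.sub_add_cancel, hc, show 5 ≤ n by omega] using this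
    · have := hB5 (n - 5) (k - 5) a b (c - (N - 1)) (ih _ (by omega) (by omega) (by omega)
        (by omega) (by rw [Nat.mul_sub N]; omega) (by omega))
      simpa only [Nat.sub_add_cancel, show N - 1 ≤ c by omega, show 5 ≤ n by omega,
        show 5 ≤ k by omega] using this
  -- the short cycles have fewer than `15 * N` edges, and the long one has at most `n`
  exfalso
  interval_cases N <;> omega

/-! ### Decompositions from an atlas -/

section

variable {F : Frame} {d : ℕ}

theorem Closed.zero : Closed F d 0 0 := ⟨[], rfl, by simp, by simp [Fills, cyclesEdges]⟩

variable (F d) in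
/-- `n` columns are covered by an opening, a closing and a closed segment, whose long cycle has
length `k` and whose other cycles have lengths `L`. The three segments need not occur in this
order; as the long cycle is not closed yet, passing segments can still be inserted. -/
def Realized (n k : ℕ) (L : Multiset ℕ) : Prop :=
  ∃ l₁ k₁ L₁ l₂ k₂ L₂ l₃ L₃, Opening F d l₁ k₁ L₁ ∧ Closing F d l₂ k₂ L₂ ∧ Closed F d l₃ L₃ ∧
    n = l₁ + l₂ + l₃ ∧ k = k₁ + k₂ ∧ L = L₁ + L₂ + L₃

theorem Realized.add_closed {n k l : ℕ} {L L' : Multiset ℕ} (h : Realized F d n k L)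
    (h' : Closed F d l L') : Realized F d (n + l) k (L + L') := by
  obtain ⟨l₁, k₁, L₁, l₂, k₂, L₂, l₃, L₃, h1, h2, h3, rfl, rfl, rfl⟩ := h
  exact ⟨l₁, k₁, L₁, l₂, k₂, L₂, l₃ + l, L₃ + L', h1, h2, h3.add h', by omega, rfl,
    add_assoc _ _ _⟩

theorem Realized.add_passing {n k l k' : ℕ} {L L' : Multiset ℕ} (h : Realized F d n k L)
    (h' : Passing F d l k' L') : Realized F d (n + l) (k + k') (L + L') := by
  obtain ⟨l₁, k₁, L₁, l₂, k₂, L₂, l₃, L₃, h1, h2, h3, rfl, rfl, rfl⟩ := h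
  exact ⟨l₁ + l, k₁ + k', L₁ + L', l₂, k₂, L₂, l₃, L₃, h1.pass h', h2, h3, by omega, by omega,
    by abel⟩

theorem Realized.closed {n k : ℕ} {L : Multiset ℕ} (hAB : F.A.map Prod.fst = F.B.map Prod.fst)
    (hn : n ≤ d) (h : Realized F d n k L) : Closed F d n (L + {k}) := by
  obtain ⟨l₁, k₁, L₁, l₂, k₂, L₂, l₃, L₃, h1, h2, h3, rfl, rfl, rfl⟩ := h
  have := (h1.close hAB (by omega) h2).add h3
  convert this using 1
  abel

theorem exists_eq_short {m : List ℕ} (hm : ∀ x ∈ m, x = 3 ∨ x = 4 ∨ x = 5) :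
    ∃ a b c, (m : Multiset ℕ) = short a b c ∧ 3 * a + 4 * b + 5 * c = m.sum := by
  induction m with
  | nil => exact ⟨0, 0, 0, rfl, rfl⟩
  | cons x m ih =>
    obtain ⟨a, b, c, h, hs⟩ := ih fun x hx => hm x (List.mem_cons_of_mem _ hx)
    have h1 : ((x :: m : List ℕ) : Multiset ℕ) = m + {x} := by
      rw [← Multiset.cons_coe, add_comm, Multiset.singleton_add]
    rw [h1, h, List.sum_cons, ← hs]
    rcases hm x (by simp) with rfl | rfl | rfl
    · exact ⟨a + 1, b, c, short_add a b c 1 0 0, by omega⟩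
    · exact ⟨a, b + 1, c, short_add a b c 0 1 0, by omega⟩
    · exact ⟨a, b, c + 1, short_add a b c 0 0 1, by omega⟩

end

/-- A finite atlas of segments for one connection set: a frame, the number `N` of differences, the
least number `d` of vertices, kinds and explicit data of closed, passing, opening and closing
segments, and the tables of lists that these do not realize for fewer than `d` columns. -/
structure Atlas where
  F : Frame
  N : ℕ
  d : ℕ
  closed : List Kind
  passing : List Kind
  opening : List Kind
  closing : List Kind
  closedData : List (List (List ℕ))
  passingData : List Piece
  openingData : List Piece
  closingData : List Piece
  table₀ : List (List ℕ)
  table : List (List (List ℕ))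

/-- The finitely many properties of an atlas from which decompositions for all `n ≥ d` follow. The
tables have no rows for `n ≥ d`, so from there on nothing is omitted. The cover tests extend to the
numbers of columns from which `extend_cover₀` (with `9` as its least number) and `extend_cover` take
over. -/
structure Atlas.Valid (Z : Atlas) : Prop where
  profiles : Z.F.A.map Prod.fst = Z.F.B.map Prod.fst
  nodup : (Z.F.A.map Prod.fst).Nodup
  small : ∀ s ∈ Z.F.A.map Prod.fst, 0 < s ∧ 2 * s < Z.d
  card : 3 ≤ Z.N ∧ Z.N ≤ 8
  closed : matchTest (closedTest Z.F Z.d) Z.closed Z.closedData = true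
  passing : matchTest (passTest Z.F Z.d) Z.passing Z.passingData = true
  opening : matchTest (openTest Z.F Z.d) Z.opening Z.openingData = true
  closing : matchTest (closeTest Z.F Z.d) Z.closing Z.closingData = true
  closed_sum : ∀ t ∈ Z.closed, 3 * t.a + 4 * t.b + 5 * t.c = Z.N * t.l
  passing_sum : ∀ t ∈ Z.passing, 3 * t.a + 4 * t.b + 5 * t.c + t.l = Z.N * t.l
  closed_pure : Z.closed.take 3 = [⟨6, 0, 2 * Z.N, 0, 0⟩, ⟨4, 0, 0, Z.N, 0⟩, ⟨5, 0, 0, 0, Z.N⟩]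
  passing_pure : Z.passing.take 3 =
    [⟨6, 6, 2 * Z.N - 2, 0, 0⟩, ⟨4, 4, 0, Z.N - 1, 0⟩, ⟨5, 5, 0, 0, Z.N - 1⟩]
  table₀_length : Z.table₀.length ≤ 9 ∧ Z.table₀.length ≤ Z.d
  table_length : Z.table.length ≤ Z.d
  cover₀ : coverTest₀ Z.N 15 Z.table₀ Z.closed = true
  cover : coverTest Z.N (max 17 (Z.d + 6)) Z.table Z.closed Z.passing Z.opening Z.closing = true

section

variable {Z : Atlas} {n : ℕ}

theorem Atlas.Valid.closed_of_mem (hZ : Z.Valid) (hn : Z.d ≤ n) {t : Kind} (ht : t ∈ Z.closed) :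
    0 < t.l ∧ Closed Z.F n t.l (short t.a t.b t.c) := by
  obtain ⟨p, hp⟩ := exists_of_matchTest hZ.closed t ht
  exact closed_of_test hn hp

theorem Atlas.Valid.pure_mem_closed (hZ : Z.Valid) {t : Kind} (ht : t ∈ [⟨6, 0, 2 * Z.N, 0, 0⟩,
    ⟨4, 0, 0, Z.N, 0⟩, (⟨5, 0, 0, 0, Z.N⟩ : Kind)]) : t ∈ Z.closed := by
  rw [← hZ.closed_pure] at ht
  exact List.mem_of_mem_take ht

theorem Atlas.Valid.pure_mem_passing (hZ : Z.Valid) {t : Kind} (ht : t ∈ [⟨6, 6, 2 * Z.N - 2, 0, 0⟩,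
    ⟨4, 4, 0, Z.N - 1, 0⟩, (⟨5, 5, 0, 0, Z.N - 1⟩ : Kind)]) : t ∈ Z.passing := by
  rw [← hZ.passing_pure] at ht
  exact List.mem_of_mem_take ht

/-- Lists of threes, fours and fives are realized unless they are exceptional. -/
theorem Atlas.Valid.closed_short (hZ : Z.Valid) (hn : Z.d ≤ n) {a b c : ℕ}
    (hs : 3 * a + 4 * b + 5 * c = Z.N * n) (he : exceptional Z.N n b c = false) :
    Closed Z.F n n (short a b c) := by
  have hstep : ∀ f ∈ Z.closed, ∀ n' a b c, Closed Z.F n n' (short a b c) →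
      Closed Z.F n (n' + f.l) (short (a + f.a) (b + f.b) (c + f.c)) := by
    intro f hf n' a b c h
    rw [← short_add]
    exact h.add (hZ.closed_of_mem hn hf).2
  have hbase : ∀ n' a b c, Z.table₀.length ≤ n' → n' < 15 → 3 * a + 4 * b + 5 * c = Z.N * n' →
      exceptional Z.N n' b c = false → Closed Z.F n n' (short a b c) := by
    intro n' a b c hl hn' hs he
    refine of_coverTest₀ (P := fun n' a b c => Closed Z.F n n' (short a b c)) hZ.cover₀
      Closed.zero (fun f hf => ⟨(hZ.closed_of_mem hn hf).1, hZ.closed_sum f hf, hstep f hf⟩)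
      hn' hs ?_
    rw [omitted₀, he, List.getD_eq_default _ _ hl]
    rfl
  by_cases hlt : n < 15
  · exact hbase n a b c (hZ.table₀_length.2.trans hn) hlt hs he
  · exact extend_cover₀ (P := fun n' a b c => Closed Z.F n n' (short a b c)) (n₀ := 9) hZ.card
      (fun n' a b c h h' => hbase n' a b c (hZ.table₀_length.1.trans h) h') le_rfl
      (hstep _ (hZ.pure_mem_closed (t := ⟨6, 0, 2 * Z.N, 0, 0⟩) (by simp)))
      (hstep _ (hZ.pure_mem_closed (t := ⟨4, 0, 0, Z.N, 0⟩) (by simp)))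
      (hstep _ (hZ.pure_mem_closed (t := ⟨5, 0, 0, 0, Z.N⟩) (by simp))) (by omega) hs he

/-- Lists of threes, fours and fives with one number `k ≥ 6` are realized unless all other numbers
are threes and the numbers of columns and differences are special. -/
theorem Atlas.Valid.closed_long (hZ : Z.Valid) (hn : Z.d ≤ n) {k a b c : ℕ} (hk : 6 ≤ k)
    (hkn : k ≤ n) (hs : 3 * a + 4 * b + 5 * c + k = Z.N * n) (he : hexagonal Z.N n k b c = false) :
    Closed Z.F n n (short a b c + {k}) := by
  refine Realized.closed hZ.profiles le_rfl ?_
  have hA : ∀ f ∈ Z.closed, ∀ n' k a b c, Realized Z.F n n' k (short a b c) →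
      Realized Z.F n (n' + f.l) k (short (a + f.a) (b + f.b) (c + f.c)) := by
    intro f hf n' k a b c h
    rw [← short_add]
    exact h.add_closed (hZ.closed_of_mem hn hf).2
  have hB : ∀ f ∈ Z.passing, 0 < f.l ∧ ∀ n' k a b c, Realized Z.F n n' k (short a b c) →
      Realized Z.F n (n' + f.l) (k + f.l) (short (a + f.a) (b + f.b) (c + f.c)) := by
    intro f hf
    obtain ⟨p, hp⟩ := exists_of_matchTest hZ.passing f hf
    obtain ⟨h0, hk, hpass⟩ := passing_of_test hn hp
    refine ⟨h0, fun n' k a b c h => ?_⟩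
    rw [← short_add]
    have := h.add_passing hpass
    rwa [hk] at this
  have hLR : ∀ f ∈ Z.opening, ∀ g ∈ Z.closing, Realized Z.F n (f.l + g.l) (f.k + g.k)
      (short (f.a + g.a) (f.b + g.b) (f.c + g.c)) := by
    intro f hf g hg
    obtain ⟨p, hp⟩ := exists_of_matchTest hZ.opening f hf
    obtain ⟨q, hq⟩ := exists_of_matchTest hZ.closing g hg
    exact ⟨_, _, _, _, _, _, _, _, opening_of_test hn hp, closing_of_test hn hq, Closed.zero,
      rfl, rfl, by rw [short_add, add_zero]⟩
  refine extend_cover (P := fun n' k a b c => Realized Z.F n n' k (short a b c)) (n₀ := Z.d)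
    (n₁ := max 16 (Z.d + 5)) hZ.card (by omega) ?_
    (hA _ (hZ.pure_mem_closed (t := ⟨6, 0, 2 * Z.N, 0, 0⟩) (by simp)))
    (hA _ (hZ.pure_mem_closed (t := ⟨4, 0, 0, Z.N, 0⟩) (by simp)))
    (hA _ (hZ.pure_mem_closed (t := ⟨5, 0, 0, 0, Z.N⟩) (by simp)))
    (hB _ (hZ.pure_mem_passing (t := ⟨6, 6, 2 * Z.N - 2, 0, 0⟩) (by simp))).2
    (hB _ (hZ.pure_mem_passing (t := ⟨4, 4, 0, Z.N - 1, 0⟩) (by simp))).2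
    (hB _ (hZ.pure_mem_passing (t := ⟨5, 5, 0, 0, Z.N - 1⟩) (by simp))).2 hn hk hkn hs he
  intro n' k a b c hn' hn'' hk hkn hs he
  refine of_coverTest (P := fun n' k a b c => Realized Z.F n n' k (short a b c)) hZ.cover
    (fun f hf => ⟨(hZ.closed_of_mem hn hf).1, hZ.closed_sum f hf, hA f hf⟩)
    (fun f hf => ⟨(hB f hf).1, hZ.passing_sum f hf, (hB f hf).2⟩) hLR (by omega) hk hkn hs ?_
  rw [omitted, he, List.getD_eq_default _ _ (hZ.table_length.trans hn')]
  rfl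

theorem Atlas.Valid.hasDecomposition (hZ : Z.Valid) [NeZero n] (hn : Z.d ≤ n) {m : List ℕ} {k : ℕ}
    (hm : ∀ x ∈ m, x = 3 ∨ x = 4 ∨ x = 5) (hk3 : 3 ≤ k) (hkn : k ≤ n)
    (hsum : (m ++ [k]).sum = Z.N * n)
    (hexc : ∀ a b c, ((m ++ [k] : List ℕ) : Multiset ℕ) = short a b c →
      3 * a + 4 * b + 5 * c = Z.N * n → exceptional Z.N n b c = false)
    (hhex : ∀ a, 3 * a + 6 = Z.N * n → Z.N = 5 → n % 6 = 3 →
      Closed Z.F n n (short a 0 0 + {6})) :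
    HasDecomposition (circ n (Z.F.A.map Prod.fst).toFinset) (m ++ [k]) := by
  have hM : ∀ x ∈ m ++ [k], 2 ≤ x := by
    intro x hx
    rcases List.mem_append.1 hx with hx | hx
    · have := hm x hx
      omega
    · rw [List.mem_singleton.1 hx]
      omega
  refine Closed.hasDecomposition hZ.nodup (fun s hs => (hZ.small s hs).1)
    (fun s hs => (hZ.small s hs).2.trans_le hn) hM ?_
  by_cases hk : k < 6
  · obtain ⟨a, b, c, h, hs⟩ := exists_eq_short (m := m ++ [k]) (by
      intro x hx
      rcases List.mem_append.1 hx with hx | hx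
      · exact hm x hx
      · rw [List.mem_singleton.1 hx]
        omega)
    rw [h]
    exact hZ.closed_short hn (hs.trans hsum) (hexc a b c h (hs.trans hsum))
  · obtain ⟨a, b, c, h, hs⟩ := exists_eq_short hm
    rw [← Multiset.coe_add, h, Multiset.coe_singleton]
    have hs' : 3 * a + 4 * b + 5 * c + k = Z.N * n := by
      rw [hs, ← hsum, List.sum_append, List.sum_singleton]
    by_cases he : hexagonal Z.N n k b c = false
    · exact hZ.closed_long hn (by omega) hkn hs' he
    · rw [hexagonal_eq_false, not_not] at he
      obtain ⟨hN, rfl, rfl, rfl, h6⟩ := he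
      exact hhex a (by omega) hN h6

end

/-! ### The six atlases -/

/-- The atlas for the differences 1, 2, 3. -/
def atlas₃ : Atlas where
  F :=
    { A := [(1, 2), (2, 0), (3, 0)]
      B := [(1, 3), (2, 3), (3, 2)]
      lo := 3, hi := 4, x := 2, y := 3 }
  N := 3
  d := 7
  closed := [⟨6, 0, 6, 0, 0⟩, ⟨4, 0, 0, 3, 0⟩, ⟨5, 0, 0, 0, 3⟩, ⟨1, 0, 1, 0, 0⟩, ⟨3, 0, 0, 1, 1⟩]
  passing := [⟨6, 6, 4, 0, 0⟩, ⟨4, 4, 0, 2, 0⟩, ⟨5, 5, 0, 0, 2⟩, ⟨2, 2, 0, 1, 0⟩, ⟨3, 3, 2, 0, 0⟩]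
  opening := [⟨7, 7, 0, 0, 4⟩, ⟨6, 4, 0, 0, 4⟩, ⟨4, 3, 0, 0, 3⟩, ⟨6, 6, 6, 0, 0⟩, ⟨6, 6, 1, 0, 3⟩,
    ⟨4, 3, 5, 0, 0⟩, ⟨5, 4, 0, 3, 1⟩, ⟨4, 2, 0, 4, 0⟩, ⟨2, 2, 0, 0, 2⟩, ⟨2, 2, 2, 1, 0⟩,
    ⟨1, 1, 1, 0, 1⟩, ⟨1, 1, 0, 2, 0⟩]
  closing := [⟨7, 5, 0, 0, 2⟩, ⟨6, 6, 2, 0, 0⟩, ⟨5, 5, 0, 1, 0⟩, ⟨3, 3, 0, 0, 0⟩]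
  closedData := [
    [[0, 2, 3], [1, 3, 4], [2, 4, 5], [3, 5, 6], [4, 6, 7], [5, 7, 8]],
    [[0, 2, 5, 3], [1, 3, 2, 4], [3, 4, 5, 6]],
    [[0, 2, 4, 5, 3], [1, 3, 6, 7, 4], [2, 3, 4, 6, 5]],
    [[0, 2, 3]],
    [[1, 3, 2, 4], [0, 2, 5, 4, 3]]]
  passingData := [
    ⟨[[3, 5, 6], [4, 5, 7], [6, 8, 9], [7, 8, 10]], [5, 8], [4, 6, 7, 9]⟩,
    ⟨[[3, 4, 6, 5], [5, 7, 6, 8]], [5, 4, 7], [6]⟩,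
    ⟨[[3, 5, 8, 7, 6], [4, 5, 7, 9, 6]], [5, 6, 8], [4, 7]⟩,
    ⟨[[3, 5, 4, 6]], [5], [4]⟩,
    ⟨[[3, 5, 6], [4, 5, 7]], [5], [4, 6]⟩]
  openingData := [
    ⟨[[0, 2, 4, 6, 3], [1, 3, 2, 5, 4], [5, 7, 9, 11, 8], [6, 7, 10, 9, 8]],
      [9, 6, 5, 3, 4, 7, 8, 10], []⟩,
    ⟨[[0, 2, 4, 6, 3], [1, 3, 2, 5, 4], [3, 4, 7, 8, 5], [6, 7, 10, 8, 9]], [8, 6, 5, 7, 9], []⟩,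
    ⟨[[0, 2, 4, 1, 3], [2, 3, 6, 8, 5], [3, 4, 7, 6, 5]], [6, 4, 5, 7], []⟩,
    ⟨[[0, 2, 3], [1, 3, 4], [2, 4, 5], [5, 6, 7], [6, 8, 9], [7, 8, 10]],
      [8, 5, 3, 6, 4, 7, 9], []⟩,
    ⟨[[0, 2, 3], [1, 3, 5, 6, 4], [2, 4, 7, 8, 5], [6, 7, 10, 8, 9]], [8, 6, 3, 4, 5, 7, 9], []⟩,
    ⟨[[0, 2, 3], [1, 3, 4], [2, 4, 5], [4, 6, 7], [5, 6, 8]], [6, 3, 5, 7], []⟩,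
    ⟨[[1, 3, 2, 4], [3, 4, 7, 5], [6, 8, 7, 9], [0, 2, 5, 6, 3]], [7, 6, 4, 5, 8], []⟩,
    ⟨[[0, 2, 4, 3], [1, 3, 5, 4], [2, 3, 6, 5], [5, 7, 6, 8]], [6, 4, 7], []⟩,
    ⟨[[0, 2, 4, 6, 3], [1, 3, 2, 5, 4]], [4, 3, 5], []⟩,
    ⟨[[0, 2, 3], [2, 4, 5], [1, 3, 6, 4]], [4, 3, 5], []⟩,
    ⟨[[2, 3, 5], [0, 2, 4, 1, 3]], [3, 4], []⟩,
    ⟨[[0, 2, 5, 3], [1, 3, 2, 4]], [3, 4], []⟩]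
  closingData := [
    ⟨[[3, 5, 8, 9, 6], [4, 5, 7, 8, 6]], [4, 7, 6, 5], []⟩,
    ⟨[[3, 4, 5], [5, 6, 7]], [6, 4, 7, 8, 5], []⟩,
    ⟨[[3, 5, 4, 6]], [4, 7, 6, 5], []⟩,
    ⟨[], [4, 5], []⟩]
  table₀ := []
  table := [
    [],
    [],
    [],
    [],
    [],
    [],
    [[0]]]

theorem atlas₃_valid : atlas₃.Valid where
  profiles := by decide +kernel
  nodup := by decide +kernel
  small := by decide +kernel
  card := by decide +kernel
  closed := by decide +kernel
  passing := by decide +kernel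
  opening := by decide +kernel
  closing := by decide +kernel
  closed_sum := by decide +kernel
  passing_sum := by decide +kernel
  closed_pure := by rfl
  passing_pure := by rfl
  table₀_length := by decide +kernel
  table_length := by decide +kernel
  cover₀ := by decide +kernel
  cover := by decide +kernel

/-- The atlas for the differences 1, 2, 3, 4. -/
def atlas₄ : Atlas where
  F :=
    { A := [(1, 1), (2, 0), (3, 1), (4, 0)]
      B := [(1, 1), (2, 2), (3, 2), (4, 1)]
      lo := 2, hi := 4, x := 2, y := 3 }
  N := 4
  d := 9
  closed := [⟨6, 0, 8, 0, 0⟩, ⟨4, 0, 0, 4, 0⟩, ⟨5, 0, 0, 0, 4⟩, ⟨1, 0, 0, 1, 0⟩, ⟨2, 0, 1, 0, 1⟩,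
    ⟨3, 0, 4, 0, 0⟩]
  passing := [⟨6, 6, 6, 0, 0⟩, ⟨4, 4, 0, 3, 0⟩, ⟨5, 5, 0, 0, 3⟩, ⟨3, 3, 0, 1, 1⟩, ⟨1, 1, 1, 0, 0⟩]
  opening := [⟨6, 4, 8, 0, 0⟩, ⟨4, 5, 0, 0, 3⟩, ⟨5, 4, 0, 0, 4⟩, ⟨3, 4, 0, 3, 0⟩, ⟨5, 6, 6, 0, 0⟩,
    ⟨3, 4, 1, 1, 1⟩, ⟨2, 3, 0, 1, 1⟩]
  closing := [⟨7, 4, 0, 0, 4⟩, ⟨6, 5, 0, 0, 3⟩, ⟨5, 4, 0, 3, 0⟩, ⟨3, 2, 2, 0, 0⟩, ⟨4, 2, 0, 0, 2⟩,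
    ⟨2, 1, 1, 0, 0⟩]
  closedData := [
    [[0, 2, 4], [1, 2, 5], [1, 3, 4], [2, 3, 6], [3, 5, 7], [4, 5, 8], [4, 6, 7], [5, 6, 9]],
    [[0, 2, 5, 4], [1, 2, 6, 3], [1, 4, 3, 5], [2, 3, 7, 4]],
    [[0, 2, 1, 3, 4], [1, 4, 2, 3, 5], [2, 5, 8, 4, 6], [3, 6, 5, 4, 7]],
    [[0, 2, 1, 4]],
    [[1, 2, 3], [0, 2, 5, 1, 4]],
    [[0, 2, 4], [1, 2, 5], [1, 3, 4], [2, 3, 6]]]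
  passingData := [
    ⟨[[1, 2, 5], [2, 3, 4], [3, 5, 6], [4, 6, 8], [5, 7, 9], [6, 7, 10]], [6, 9], [7, 4, 5, 8]⟩,
    ⟨[[1, 2, 3, 5], [2, 4, 3, 6], [4, 7, 5, 8]], [5, 4, 6], [7]⟩,
    ⟨[[1, 2, 4, 8, 5], [2, 3, 4, 6, 5], [3, 6, 9, 5, 7]], [6, 8], [5, 4, 7]⟩,
    ⟨[[2, 3, 7, 4], [1, 2, 6, 3, 5]], [5], [4, 6]⟩,
    ⟨[[1, 2, 5]], [4], []⟩]
  openingData := [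
    ⟨[[0, 2, 4], [1, 2, 3], [1, 4, 5], [2, 5, 6], [3, 4, 7], [4, 6, 8], [5, 7, 9], [6, 7, 10]],
      [8, 5, 3, 6, 9], []⟩,
    ⟨[[0, 2, 5, 8, 4], [1, 2, 6, 3, 4], [1, 3, 7, 4, 5]], [6, 4, 2, 3, 5, 7], []⟩,
    ⟨[[0, 2, 3, 6, 4], [1, 2, 6, 9, 5], [1, 3, 5, 7, 4], [2, 4, 8, 6, 5]], [7, 3, 4, 5, 8], []⟩,
    ⟨[[0, 2, 1, 4], [1, 3, 2, 5], [3, 6, 4, 7]], [5, 3, 4, 2, 6], []⟩,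
    ⟨[[0, 2, 4], [1, 2, 3], [1, 4, 5], [3, 5, 7], [4, 6, 8], [5, 6, 9]], [7, 4, 3, 6, 2, 5, 8], []⟩,
    ⟨[[1, 2, 5], [1, 3, 7, 4], [0, 2, 6, 3, 4]], [5, 3, 2, 4, 6], []⟩,
    ⟨[[1, 2, 6, 3], [0, 2, 5, 1, 4]], [4, 2, 3, 5], []⟩]
  closingData := [
    ⟨[[1, 2, 3, 4, 5], [2, 5, 7, 3, 6], [4, 7, 10, 6, 8], [5, 8, 7, 6, 9]], [5, 6, 4], []⟩,
    ⟨[[1, 2, 4, 8, 5], [2, 3, 4, 6, 5], [3, 6, 9, 5, 7]], [5, 4, 7, 6], []⟩,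
    ⟨[[1, 2, 3, 5], [2, 4, 8, 5], [3, 6, 4, 7]], [4, 5, 6], []⟩,
    ⟨[[1, 2, 5], [2, 3, 6]], [4], []⟩,
    ⟨[[1, 2, 6, 3, 5], [2, 3, 7, 4, 5]], [4], []⟩,
    ⟨[[1, 2, 5]], [], []⟩]
  table₀ := []
  table := [
    [],
    [],
    [],
    [],
    [],
    [],
    [[202, 0]],
    [[2, 100], [202]],
    [[200, 1], [2], [202]]]

theorem atlas₄_valid : atlas₄.Valid where
  profiles := by decide +kernel
  nodup := by decide +kernel
  small := by decide +kernel
  card := by decide +kernel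
  closed := by decide +kernel
  passing := by decide +kernel
  opening := by decide +kernel
  closing := by decide +kernel
  closed_sum := by decide +kernel
  passing_sum := by decide +kernel
  closed_pure := by rfl
  passing_pure := by rfl
  table₀_length := by decide +kernel
  table_length := by decide +kernel
  cover₀ := by decide +kernel
  cover := by decide +kernel

/-- The atlas for the differences 1, 2, 3, 4, 6. -/
def atlas₅ : Atlas where
  F :=
    { A := [(1, 3), (2, 2), (3, 0), (4, 2), (6, 0)]
      B := [(1, 3), (2, 3), (3, 3), (4, 0), (6, 0)]
      lo := 2, hi := 5, x := 3, y := 4 }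
  N := 5
  d := 13
  closed := [⟨6, 0, 10, 0, 0⟩, ⟨4, 0, 0, 5, 0⟩, ⟨5, 0, 0, 0, 5⟩, ⟨1, 0, 0, 0, 1⟩, ⟨3, 0, 1, 3, 0⟩,
    ⟨3, 0, 2, 1, 1⟩, ⟨4, 0, 4, 2, 0⟩, ⟨5, 0, 5, 0, 2⟩, ⟨5, 0, 7, 1, 0⟩, ⟨8, 0, 12, 1, 0⟩]
  passing := [⟨6, 6, 8, 0, 0⟩, ⟨4, 4, 0, 4, 0⟩, ⟨5, 5, 0, 0, 4⟩, ⟨1, 1, 0, 1, 0⟩]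
  opening := [⟨7, 7, 10, 0, 0⟩, ⟨6, 5, 9, 0, 0⟩, ⟨6, 8, 8, 0, 0⟩, ⟨7, 4, 11, 0, 0⟩,
    ⟨5, 7, 5, 0, 1⟩, ⟨5, 7, 0, 0, 4⟩, ⟨5, 3, 0, 1, 4⟩, ⟨3, 2, 5, 0, 0⟩, ⟨3, 5, 0, 3, 0⟩,
    ⟨2, 4, 1, 0, 1⟩, ⟨3, 5, 4, 0, 0⟩, ⟨2, 3, 3, 0, 0⟩, ⟨2, 2, 2, 1, 0⟩]
  closing := [⟨12, 7, 17, 0, 0⟩, ⟨11, 8, 15, 0, 0⟩, ⟨10, 3, 15, 0, 0⟩, ⟨11, 5, 16, 0, 0⟩,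
    ⟨9, 7, 12, 0, 0⟩, ⟨8, 6, 0, 8, 0⟩, ⟨9, 6, 11, 1, 0⟩, ⟨8, 4, 10, 1, 0⟩, ⟨5, 3, 0, 0, 4⟩,
    ⟨6, 4, 4, 3, 0⟩, ⟨5, 1, 6, 1, 0⟩, ⟨4, 2, 2, 0, 2⟩, ⟨3, 1, 0, 3, 0⟩, ⟨4, 1, 4, 0, 1⟩,
    ⟨3, 1, 1, 1, 1⟩]
  closedData := [
    [[0, 3, 6], [1, 4, 7], [2, 4, 8], [2, 5, 6], [3, 4, 5], [3, 7, 9], [4, 6, 10], [5, 7, 11],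
     [5, 8, 9], [6, 7, 8]],
    [[0, 3, 7, 6], [1, 4, 5, 7], [2, 4, 3, 5], [2, 6, 4, 8], [3, 6, 5, 9]],
    [[0, 3, 9, 5, 6], [1, 4, 2, 8, 7], [2, 5, 4, 8, 6], [3, 4, 6, 7, 5], [3, 6, 10, 4, 7]],
    [[0, 3, 4, 2, 6]],
    [[2, 4, 5], [0, 3, 5, 6], [1, 4, 3, 7], [2, 6, 4, 8]],
    [[2, 4, 8], [4, 5, 6], [1, 4, 3, 7], [0, 3, 5, 2, 6]],
    [[2, 4, 8], [2, 5, 6], [3, 4, 6], [3, 5, 9], [0, 3, 7, 6], [1, 4, 5, 7]],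
    [[2, 4, 5], [2, 6, 8], [3, 4, 6], [3, 5, 7], [4, 7, 8], [0, 3, 9, 5, 6], [1, 4, 10, 6, 7]],
    [[0, 3, 6], [2, 4, 5], [2, 6, 8], [3, 4, 7], [3, 5, 9], [4, 6, 10], [5, 6, 7], [1, 4, 8, 7]],
    [[1, 4, 7], [2, 4, 8], [2, 5, 6], [3, 4, 5], [3, 6, 7], [4, 6, 10], [5, 7, 8], [5, 9, 11],
     [6, 8, 12], [7, 9, 13], [7, 10, 11], [8, 9, 10], [0, 3, 9, 6]]]
  passingData := [
    ⟨[[0, 4, 6], [1, 5, 7], [2, 6, 8], [3, 4, 5], [3, 6, 9], [4, 7, 10], [5, 8, 11], [7, 8, 9]],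
      [7, 6, 5, 9], [8, 10]⟩,
    ⟨[[0, 4, 7, 6], [1, 5, 3, 7], [2, 6, 5, 8], [3, 4, 6, 9]], [6, 8], [5, 7]⟩,
    ⟨[[0, 4, 7, 8, 6], [1, 5, 4, 10, 7], [2, 6, 3, 4, 8], [3, 7, 5, 6, 9]], [5, 8], [6, 7, 9]⟩,
    ⟨[[0, 4, 3, 6]], [5], []⟩]
  openingData := [
    ⟨[[0, 3, 6], [1, 4, 7], [2, 4, 8], [2, 5, 6], [3, 4, 5], [5, 7, 8], [5, 9, 11], [6, 8, 10],
      [6, 9, 12], [7, 9, 10]], [10, 4, 6, 7, 3, 9, 8, 11], []⟩,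
    ⟨[[0, 3, 6], [1, 4, 7], [2, 4, 8], [2, 5, 6], [3, 4, 5], [3, 7, 9], [5, 8, 11], [6, 8, 9],
      [7, 8, 10]], [9, 5, 7, 6, 4, 10], []⟩,
    ⟨[[0, 3, 6], [1, 4, 7], [2, 4, 5], [3, 7, 9], [4, 8, 10], [5, 6, 7], [5, 8, 11], [6, 8, 9]],
      [9, 5, 3, 4, 6, 2, 8, 7, 10], []⟩,
    ⟨[[0, 3, 6], [1, 4, 7], [2, 4, 8], [2, 5, 6], [3, 4, 5], [3, 7, 9], [4, 6, 10], [5, 8, 11],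
      [6, 7, 8], [6, 9, 12], [8, 9, 10]], [10, 7, 5, 9, 11], []⟩,
    ⟨[[0, 3, 6], [2, 5, 8], [3, 7, 9], [4, 5, 6], [4, 7, 10], [1, 4, 8, 6, 7]],
      [8, 7, 5, 3, 4, 2, 6, 9], []⟩,
    ⟨[[0, 3, 5, 4, 6], [1, 4, 8, 5, 7], [2, 4, 10, 7, 6], [3, 7, 8, 6, 9]],
      [8, 2, 5, 6, 3, 4, 7, 9], []⟩,
    ⟨[[0, 3, 4, 6], [1, 4, 5, 6, 7], [2, 4, 10, 7, 5], [2, 6, 3, 5, 8], [3, 7, 8, 6, 9]],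
      [8, 4, 7, 9], []⟩,
    ⟨[[0, 3, 6], [1, 4, 7], [2, 4, 6], [2, 5, 8], [3, 4, 5]], [6, 5, 7], []⟩,
    ⟨[[0, 3, 4, 6], [1, 4, 5, 7], [2, 6, 5, 8]], [6, 3, 5, 2, 4, 7], []⟩,
    ⟨[[1, 4, 7], [0, 3, 5, 4, 6]], [5, 2, 4, 3, 6], []⟩,
    ⟨[[0, 3, 6], [1, 4, 7], [2, 5, 8], [4, 5, 6]], [6, 2, 4, 3, 5, 7], []⟩,
    ⟨[[0, 3, 6], [1, 4, 7], [2, 4, 5]], [5, 3, 4, 6], []⟩,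
    ⟨[[0, 3, 6], [1, 4, 7], [2, 4, 3, 5]], [5, 4, 6], []⟩]
  closingData := [
    ⟨[[0, 4, 6], [1, 5, 7], [2, 6, 8], [3, 4, 7], [3, 5, 6], [4, 5, 8], [5, 9, 11], [6, 7, 10],
      [6, 9, 12], [7, 8, 11], [8, 9, 10], [8, 12, 14], [9, 13, 15], [10, 12, 16], [10, 13, 14],
      [11, 13, 17], [11, 14, 15]], [10, 11, 12, 13, 7, 9], []⟩,
    ⟨[[0, 4, 6], [1, 5, 7], [2, 6, 8], [3, 4, 5], [3, 7, 9], [4, 8, 10], [5, 6, 9], [5, 8, 11],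
      [6, 7, 10], [7, 11, 13], [8, 12, 14], [9, 11, 15], [9, 12, 13], [10, 12, 16], [10, 13, 14]],
      [7, 8, 9, 10, 11, 12, 6], []⟩,
    ⟨[[0, 4, 6], [1, 5, 7], [2, 6, 8], [3, 4, 5], [3, 6, 7], [4, 7, 8], [5, 6, 9], [5, 8, 11],
      [6, 10, 12], [7, 9, 13], [7, 10, 11], [8, 9, 12], [8, 10, 14], [9, 11, 15], [11, 12, 13]],
      [10, 9], []⟩,
    ⟨[[0, 4, 6], [1, 5, 7], [2, 6, 8], [3, 4, 5], [3, 7, 9], [4, 7, 8], [5, 6, 9], [5, 8, 11],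
      [6, 7, 10], [7, 11, 13], [8, 9, 10], [8, 12, 14], [9, 11, 15], [9, 12, 13], [10, 12, 16],
      [10, 13, 14]], [10, 11, 12, 6], []⟩,
    ⟨[[0, 4, 6], [1, 5, 7], [2, 6, 8], [3, 4, 7], [3, 6, 9], [4, 5, 8], [5, 9, 11], [6, 10, 12],
      [7, 9, 13], [7, 10, 11], [8, 10, 14], [8, 11, 12]], [10, 9, 8, 7, 6, 5], []⟩,
    ⟨[[0, 4, 3, 6], [1, 5, 11, 7], [2, 6, 12, 8], [3, 7, 10, 9], [4, 5, 8, 10], [4, 6, 8, 7],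
      [5, 7, 13, 9], [6, 9, 11, 10]], [8, 9, 7, 6, 5], []⟩,
    ⟨[[0, 4, 6], [2, 6, 8], [3, 4, 7], [3, 6, 9], [4, 5, 8], [5, 6, 7], [6, 10, 12], [7, 9, 13],
      [8, 10, 14], [8, 11, 12], [9, 10, 11], [1, 5, 11, 7]], [10, 7, 8, 9, 5], []⟩,
    ⟨[[0, 4, 6], [1, 5, 7], [3, 4, 7], [3, 5, 6], [4, 8, 10], [5, 9, 11], [6, 7, 8], [6, 9, 10],
      [7, 9, 13], [7, 10, 11], [2, 6, 12, 8]], [5, 8, 9], []⟩,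
    ⟨[[0, 4, 7, 8, 6], [1, 5, 4, 3, 7], [2, 6, 10, 4, 8], [3, 6, 7, 5, 9]], [6, 5], []⟩,
    ⟨[[2, 6, 8], [3, 4, 6], [3, 5, 9], [5, 7, 11], [0, 4, 10, 6], [1, 5, 8, 7], [4, 7, 9, 8]],
      [5, 6, 7], []⟩,
    ⟨[[1, 5, 7], [2, 6, 8], [3, 5, 9], [3, 6, 7], [4, 5, 6], [4, 7, 8], [0, 4, 10, 6]], [], []⟩,
    ⟨[[3, 4, 6], [5, 6, 7], [0, 4, 8, 2, 6], [1, 5, 9, 3, 7]], [5], []⟩,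
    ⟨[[0, 4, 5, 6], [1, 5, 3, 7], [2, 6, 4, 8]], [], []⟩,
    ⟨[[1, 5, 7], [3, 5, 9], [3, 6, 7], [4, 5, 6], [0, 4, 8, 2, 6]], [], []⟩,
    ⟨[[4, 5, 6], [1, 5, 3, 7], [0, 4, 8, 2, 6]], [], []⟩]
  table₀ := [[], [], [100], [], [], [400], [300], [200]]
  table := [
    [],
    [],
    [],
    [],
    [],
    [],
    [[104, 202, 0]],
    [[105, 203, 500, 200], [204, 100]],
    [[106, 204, 700, 501, 201], [205, 600, 0], [200, 1]],
    [[107, 205], [206, 800, 601, 1], [700, 100], [0]],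
    [[206], [207], [701, 0], [200], [100]],
    [[207, 1000], [0], [], [], [300], [200]],
    [[208], [1100], [], [], [], [], []]]

/-- Nine columns decomposed into thirteen triangles and a hexagon. -/
def hexagonBlock : List (List ℕ) :=
  [[0, 3, 6], [1, 4, 7], [2, 4, 8], [2, 5, 6], [3, 4, 5], [4, 6, 10], [5, 7, 11], [5, 8, 9],
   [6, 7, 8], [7, 9, 13], [8, 10, 14], [8, 11, 12], [9, 10, 11], [10, 12, 6, 9, 3, 7]]

theorem atlas₅_valid : atlas₅.Valid where
  profiles := by decide +kernel
  nodup := by decide +kernel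
  small := by decide +kernel
  card := by decide +kernel
  closed := by decide +kernel
  passing := by decide +kernel
  opening := by decide +kernel
  closing := by decide +kernel
  closed_sum := by decide +kernel
  passing_sum := by decide +kernel
  closed_pure := by rfl
  passing_pure := by rfl
  table₀_length := by decide +kernel
  table_length := by decide +kernel
  cover₀ := by decide +kernel
  cover := by decide +kernel

/-- The atlas for the differences 1, 2, 3, 4, 5, 7. -/
def atlas₆ : Atlas where
  F :=
    { A := [(1, 1), (2, 0), (3, 2), (4, 1), (5, 2), (7, 0)]
      B := [(1, 2), (2, 2), (3, 2), (4, 1), (5, 3), (7, 1)]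
      lo := 3, hi := 4, x := 2, y := 3 }
  N := 6
  d := 15
  closed := [⟨6, 0, 12, 0, 0⟩, ⟨4, 0, 0, 6, 0⟩, ⟨5, 0, 0, 0, 6⟩, ⟨1, 0, 2, 0, 0⟩, ⟨2, 0, 1, 1, 1⟩,
    ⟨3, 0, 0, 2, 2⟩, ⟨3, 0, 1, 0, 3⟩, ⟨3, 0, 2, 3, 0⟩, ⟨4, 0, 0, 1, 4⟩, ⟨6, 0, 0, 9, 0⟩]
  passing := [⟨6, 6, 10, 0, 0⟩, ⟨4, 4, 0, 5, 0⟩, ⟨5, 5, 0, 0, 5⟩, ⟨3, 3, 1, 3, 0⟩, ⟨2, 2, 2, 1, 0⟩,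
    ⟨1, 1, 0, 0, 1⟩]
  opening := [⟨6, 5, 0, 9, 0⟩, ⟨5, 3, 0, 8, 0⟩, ⟨3, 3, 0, 0, 4⟩, ⟨4, 4, 0, 0, 5⟩, ⟨3, 3, 4, 2, 0⟩,
    ⟨3, 3, 0, 5, 0⟩, ⟨4, 2, 1, 6, 0⟩, ⟨3, 2, 0, 4, 1⟩, ⟨2, 2, 2, 1, 1⟩, ⟨2, 2, 5, 0, 0⟩]
  closing := [⟨10, 10, 15, 0, 0⟩, ⟨7, 7, 10, 0, 0⟩, ⟨6, 3, 0, 7, 0⟩, ⟨7, 2, 0, 0, 7⟩,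
    ⟨5, 5, 0, 0, 4⟩, ⟨5, 5, 0, 5, 0⟩, ⟨5, 3, 0, 3, 2⟩, ⟨5, 4, 1, 2, 2⟩, ⟨5, 4, 7, 0, 0⟩]
  closedData := [
    [[0, 2, 7], [1, 2, 5], [1, 3, 8], [2, 3, 6], [2, 4, 9], [3, 4, 7], [3, 5, 10], [4, 5, 8],
     [4, 6, 11], [5, 6, 9], [5, 7, 12], [6, 7, 10]],
    [[0, 2, 3, 7], [1, 2, 4, 3], [1, 5, 4, 8], [2, 5, 3, 6], [2, 7, 4, 9], [3, 8, 5, 10]],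
    [[0, 2, 9, 4, 7], [1, 2, 6, 4, 3], [1, 5, 10, 3, 8], [2, 3, 5, 8, 4], [2, 5, 6, 3, 7],
     [4, 5, 9, 6, 11]],
    [[0, 2, 7], [1, 2, 5]],
    [[0, 2, 7], [1, 2, 6, 3], [1, 5, 2, 3, 8]],
    [[1, 2, 7, 3], [2, 4, 3, 6], [0, 2, 9, 4, 7], [1, 5, 2, 3, 8]],
    [[2, 4, 9], [0, 2, 1, 3, 7], [1, 5, 2, 3, 8], [2, 6, 3, 4, 7]],
    [[1, 2, 5], [1, 3, 8], [0, 2, 3, 7], [2, 4, 3, 6], [2, 7, 4, 9]],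
    [[1, 2, 7, 3], [0, 2, 9, 4, 7], [1, 5, 10, 3, 8], [2, 3, 5, 8, 4], [2, 5, 4, 3, 6]],
    [[0, 2, 3, 7], [1, 2, 4, 5], [1, 3, 5, 8], [2, 5, 10, 6], [2, 7, 5, 9], [3, 4, 7, 10],
     [3, 6, 4, 8], [4, 9, 6, 11], [5, 6, 7, 12]]]
  passingData := [
    ⟨[[1, 5, 8], [2, 3, 5], [2, 6, 9], [3, 4, 8], [3, 7, 10], [4, 6, 11], [4, 7, 9], [5, 6, 10],
      [5, 7, 12], [6, 8, 13]], [4, 5, 9], [6, 7, 8]⟩,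
    ⟨[[1, 5, 4, 8], [2, 3, 10, 5], [2, 6, 4, 9], [3, 4, 11, 6], [3, 7, 5, 8]], [4, 7], [5, 6]⟩,
    ⟨[[1, 5, 9, 6, 8], [2, 3, 5, 7, 4], [2, 6, 11, 4, 9], [3, 6, 5, 4, 8], [3, 7, 12, 5, 10]],
      [5, 8], [4, 6, 7]⟩,
    ⟨[[3, 4, 7], [1, 5, 3, 8], [2, 3, 10, 5], [2, 6, 4, 9]], [4, 5], [6]⟩,
    ⟨[[2, 3, 6], [2, 4, 9], [1, 5, 3, 8]], [5], [4]⟩,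
    ⟨[[1, 5, 2, 3, 8]], [4], []⟩]
  openingData := [
    ⟨[[0, 2, 9, 7], [1, 2, 7, 3], [1, 5, 7, 8], [2, 3, 8, 4], [2, 5, 10, 6], [3, 6, 7, 10],
      [4, 5, 12, 7], [4, 9, 6, 11], [5, 6, 13, 8]], [8, 6, 4, 3, 5, 9], []⟩,
    ⟨[[0, 2, 4, 7], [1, 2, 9, 5], [1, 3, 6, 8], [2, 3, 4, 6], [2, 5, 6, 7], [3, 5, 12, 7],
      [3, 8, 5, 10], [4, 9, 6, 11]], [7, 5, 4, 8], []⟩,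
    ⟨[[0, 2, 9, 4, 7], [1, 2, 6, 3, 8], [1, 3, 2, 4, 5], [2, 5, 10, 3, 7]], [5, 3, 4, 6], []⟩,
    ⟨[[0, 2, 9, 4, 7], [1, 2, 7, 5, 3], [1, 5, 10, 3, 8], [2, 3, 6, 11, 4], [2, 5, 8, 4, 6]],
      [6, 5, 4, 3, 7], []⟩,
    ⟨[[1, 2, 5], [1, 3, 8], [2, 4, 9], [3, 5, 10], [0, 2, 3, 7], [2, 6, 4, 7]], [5, 4, 3, 6], []⟩,
    ⟨[[0, 2, 4, 7], [1, 2, 7, 3], [1, 5, 3, 8], [2, 3, 10, 5], [2, 6, 4, 9]], [5, 4, 3, 6], []⟩,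
    ⟨[[0, 2, 7], [1, 2, 6, 3], [1, 5, 3, 8], [2, 3, 4, 9], [2, 4, 8, 5], [3, 7, 5, 10],
      [4, 5, 6, 11]], [6, 4, 7], []⟩,
    ⟨[[1, 2, 7, 3], [1, 5, 3, 8], [2, 3, 10, 5], [2, 4, 3, 6], [0, 2, 9, 4, 7]], [5, 4, 6], []⟩,
    ⟨[[0, 2, 7], [2, 4, 9], [1, 2, 6, 3], [1, 5, 2, 3, 8]], [4, 3, 5], []⟩,
    ⟨[[0, 2, 7], [1, 2, 5], [1, 3, 8], [2, 3, 6], [2, 4, 9]], [4, 3, 5], []⟩]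
  closingData := [
    ⟨[[1, 5, 8], [2, 3, 4], [2, 6, 9], [3, 5, 6], [3, 7, 8], [4, 6, 7], [4, 8, 11], [5, 7, 10],
      [5, 9, 12], [6, 10, 13], [7, 11, 14], [8, 9, 13], [8, 10, 15], [9, 10, 14], [9, 11, 16]],
      [10, 11, 6, 8, 12, 7, 9, 4, 5], []⟩,
    ⟨[[1, 5, 8], [2, 3, 5], [2, 4, 9], [3, 4, 6], [3, 7, 10], [4, 8, 11], [5, 6, 10], [5, 7, 12],
      [6, 7, 11], [6, 8, 13]], [8, 7, 4, 5, 9, 6], []⟩,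
    ⟨[[1, 5, 3, 8], [2, 3, 10, 6], [2, 4, 6, 9], [3, 4, 5, 6], [4, 7, 6, 11], [4, 8, 5, 9],
      [5, 10, 7, 12]], [7, 5], []⟩,
    ⟨[[1, 5, 6, 13, 8], [2, 3, 10, 5, 9], [2, 5, 4, 7, 6], [3, 5, 12, 7, 8], [3, 6, 4, 11, 7],
      [4, 8, 11, 6, 9], [5, 7, 10, 6, 8]], [4], []⟩,
    ⟨[[1, 5, 3, 4, 8], [2, 3, 8, 5, 4], [2, 6, 11, 4, 9], [3, 6, 9, 5, 10]], [7, 4, 6, 5], []⟩,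
    ⟨[[1, 5, 4, 8], [2, 3, 4, 9], [2, 4, 11, 6], [3, 5, 9, 6], [3, 8, 5, 10]], [7, 4, 6, 5], []⟩,
    ⟨[[2, 3, 10, 5], [3, 5, 4, 7], [3, 6, 5, 8], [1, 5, 9, 4, 8], [2, 4, 11, 6, 9]], [4, 6], []⟩,
    ⟨[[5, 6, 9], [2, 3, 7, 4], [3, 4, 8, 5], [1, 5, 10, 3, 8], [2, 6, 11, 4, 9]], [6, 4, 5], []⟩,
    ⟨[[1, 5, 8], [2, 3, 6], [2, 4, 9], [3, 4, 8], [3, 5, 10], [4, 6, 11], [5, 6, 9]],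
      [7, 4, 5], []⟩]
  table₀ := [[], [], [300], [], [401], [502]]
  table := [
    [],
    [],
    [],
    [],
    [],
    [],
    [[6, 502, 303, 104, 600, 401, 202, 3, 300, 101, 0]],
    [[404, 900, 205, 701, 6, 502, 104, 600, 401, 3, 300],
     [7, 503, 304, 800, 402, 203, 301, 102, 200, 1]],
    [[107, 404, 900, 205, 701, 6, 104, 600, 3, 300], [7, 503, 800, 301],
     [305, 801, 403, 302, 103, 400, 201, 2, 100]],
    [[208, 9, 505, 1001, 107, 205, 701, 6, 104, 3, 300], [108, 7, 800, 301], [801, 400],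
     [306, 802, 404, 900, 303, 401, 202, 3, 300]],
    [[110, 606, 208, 9, 1001, 107, 701, 6], [209, 10], [400], [1200, 900],
     [307, 803, 402, 203, 301]],
    [[110, 208, 9, 107, 6], [111, 1400, 10], [400], [], [], [403, 302, 400]],
    [[211, 110, 9], [], [], [], [], [], [303]],
    [[211, 110, 9], [], [], [], [], [], [], []],
    [[211, 110, 9], [], [], [], [], [], [], [], []]]

theorem atlas₆_valid : atlas₆.Valid where
  profiles := by decide +kernel
  nodup := by decide +kernel
  small := by decide +kernel
  card := by decide +kernel
  closed := by decide +kernel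
  passing := by decide +kernel
  opening := by decide +kernel
  closing := by decide +kernel
  closed_sum := by decide +kernel
  passing_sum := by decide +kernel
  closed_pure := by rfl
  passing_pure := by rfl
  table₀_length := by decide +kernel
  table_length := by decide +kernel
  cover₀ := by decide +kernel
  cover := by decide +kernel

/-- The atlas for the differences 1, 2, 3, 4, 5, 6, 7. -/
def atlas₇ : Atlas where
  F :=
    { A := [(1, 3), (2, 0), (3, 1), (4, 3), (5, 2), (6, 1), (7, 0)]
      B := [(1, 3), (2, 2), (3, 2), (4, 5), (5, 4), (6, 3), (7, 2)]
      lo := 4, hi := 4, x := 2, y := 3 }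
  N := 7
  d := 15
  closed := [⟨6, 0, 14, 0, 0⟩, ⟨4, 0, 0, 7, 0⟩, ⟨5, 0, 0, 0, 7⟩, ⟨1, 0, 1, 1, 0⟩, ⟨2, 0, 0, 1, 2⟩,
    ⟨2, 0, 3, 0, 1⟩, ⟨3, 0, 0, 4, 1⟩, ⟨3, 0, 2, 0, 3⟩, ⟨4, 0, 1, 0, 5⟩, ⟨4, 0, 8, 1, 0⟩,
    ⟨9, 0, 21, 0, 0⟩]
  passing := [⟨6, 6, 12, 0, 0⟩, ⟨4, 4, 0, 6, 0⟩, ⟨5, 5, 0, 0, 6⟩, ⟨4, 4, 0, 1, 4⟩, ⟨3, 3, 1, 0, 3⟩,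
    ⟨3, 3, 0, 2, 2⟩, ⟨2, 2, 0, 3, 0⟩, ⟨2, 2, 1, 1, 1⟩, ⟨1, 1, 2, 0, 0⟩]
  opening := [⟨9, 2, 24, 0, 0⟩, ⟨9, 8, 22, 0, 0⟩, ⟨7, 3, 19, 0, 0⟩, ⟨4, 3, 0, 4, 4⟩,
    ⟨5, 1, 0, 0, 9⟩, ⟨3, 2, 0, 0, 6⟩, ⟨4, 3, 0, 9, 0⟩, ⟨3, 1, 7, 0, 2⟩, ⟨2, 1, 5, 1, 1⟩,
    ⟨2, 1, 4, 3, 0⟩]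
  closing := [⟨7, 8, 0, 0, 6⟩, ⟨6, 6, 0, 0, 5⟩, ⟨4, 4, 0, 2, 1⟩, ⟨5, 4, 0, 0, 4⟩, ⟨5, 4, 0, 5, 0⟩,
    ⟨4, 5, 4, 0, 0⟩, ⟨2, 3, 0, 0, 0⟩]
  closedData := [
    [[0, 2, 7], [1, 3, 4], [1, 7, 8], [2, 4, 8], [2, 5, 9], [3, 5, 7], [3, 6, 10], [3, 8, 9],
     [4, 5, 10], [4, 6, 9], [4, 7, 11], [5, 6, 11], [5, 8, 12], [6, 7, 12]],
    [[0, 2, 4, 7], [1, 3, 10, 4], [1, 7, 3, 8], [2, 5, 6, 7], [2, 8, 4, 9], [3, 4, 5, 9],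
     [3, 5, 10, 6]],
    [[0, 2, 9, 3, 7], [1, 3, 10, 5, 4], [1, 7, 2, 5, 8], [2, 4, 11, 7, 8], [3, 4, 7, 6, 5],
     [3, 6, 10, 4, 8], [4, 6, 11, 5, 9]],
    [[0, 2, 7], [1, 4, 3, 7]],
    [[1, 3, 8, 4], [0, 2, 8, 1, 7], [2, 5, 4, 3, 7]],
    [[0, 2, 7], [1, 3, 7], [3, 4, 8], [1, 4, 5, 2, 8]],
    [[1, 3, 8, 4], [1, 7, 2, 8], [2, 4, 9, 5], [3, 4, 5, 6], [0, 2, 9, 3, 7]],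
    [[1, 3, 4], [4, 5, 9], [0, 2, 9, 3, 7], [1, 7, 2, 4, 8], [2, 5, 6, 3, 8]],
    [[1, 3, 4], [0, 2, 8, 1, 7], [2, 4, 8, 3, 7], [2, 5, 6, 3, 9], [3, 5, 9, 4, 10],
     [4, 5, 10, 6, 7]],
    [[0, 2, 7], [1, 3, 8], [1, 4, 7], [2, 4, 5], [3, 4, 10], [3, 5, 9], [3, 6, 7], [5, 6, 10],
     [2, 8, 4, 9]],
    [[0, 2, 7], [1, 3, 8], [1, 4, 7], [2, 4, 9], [2, 5, 8], [3, 4, 10], [3, 5, 9], [3, 6, 7],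
     [4, 5, 11], [4, 6, 8], [5, 6, 12], [5, 7, 10], [6, 9, 13], [6, 10, 11], [7, 8, 13],
     [7, 9, 14], [7, 11, 12], [8, 9, 12], [8, 10, 14], [8, 11, 15], [9, 10, 15]]]
  passingData := [
    ⟨[[2, 5, 9], [3, 4, 9], [3, 6, 10], [4, 5, 10], [4, 7, 11], [5, 6, 11], [5, 8, 12], [6, 7, 12],
      [6, 9, 13], [7, 8, 13], [7, 10, 14], [8, 9, 14]], [4, 6, 8], [5, 7, 9]⟩,
    ⟨[[2, 5, 4, 9], [3, 4, 10, 6], [3, 9, 5, 10], [4, 7, 6, 11], [5, 6, 12, 8], [5, 11, 7, 12]],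
      [4, 6], [5, 7]⟩,
    ⟨[[2, 4, 10, 3, 9], [3, 5, 7, 13, 6], [4, 5, 10, 6, 9], [4, 7, 8, 6, 11], [5, 6, 12, 7, 11],
      [5, 9, 13, 8, 12]], [5, 8], [4, 6, 7]⟩,
    ⟨[[5, 7, 12, 8], [2, 4, 6, 3, 9], [3, 5, 9, 4, 10], [4, 5, 10, 6, 11], [5, 11, 7, 6, 12]],
      [5, 6], [4, 7]⟩,
    ⟨[[4, 5, 10], [2, 5, 11, 4, 9], [3, 4, 7, 11, 6], [3, 9, 5, 6, 10]], [4, 6], [5]⟩,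
    ⟨[[2, 5, 4, 9], [4, 10, 5, 11], [3, 4, 7, 11, 6], [3, 9, 5, 6, 10]], [4, 6], [5]⟩,
    ⟨[[2, 4, 5, 9], [3, 5, 10, 6], [3, 9, 4, 10]], [5], [4]⟩,
    ⟨[[4, 5, 9], [3, 4, 10, 6], [2, 5, 10, 3, 9]], [4], [5]⟩,
    ⟨[[2, 5, 9], [3, 4, 9]], [4], []⟩]
  openingData := [
    ⟨[[0, 2, 7], [1, 3, 7], [1, 4, 8], [2, 4, 9], [2, 5, 8], [3, 4, 6], [3, 5, 10], [3, 8, 9],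
      [4, 5, 11], [4, 7, 10], [5, 6, 7], [5, 9, 12], [6, 8, 12], [6, 9, 13], [6, 10, 11],
      [7, 8, 13], [7, 9, 14], [8, 10, 14], [8, 11, 15], [9, 10, 15], [9, 11, 16], [10, 12, 16],
      [10, 13, 17], [11, 12, 17]], [11, 7, 12], []⟩,
    ⟨[[0, 2, 7], [1, 3, 8], [1, 4, 7], [2, 4, 9], [2, 5, 8], [3, 4, 10], [3, 5, 9], [3, 6, 7],
      [4, 6, 11], [5, 7, 12], [5, 10, 11], [6, 8, 12], [6, 9, 13], [7, 8, 13], [7, 9, 14],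
      [8, 10, 14], [8, 11, 15], [9, 10, 15], [9, 11, 16], [10, 12, 16], [10, 13, 17], [11, 12, 17]],
      [11, 7, 10, 6, 5, 4, 8, 9, 12], []⟩,
    ⟨[[0, 2, 7], [1, 3, 8], [1, 4, 7], [2, 4, 8], [2, 5, 9], [3, 4, 9], [3, 5, 6], [3, 7, 10],
      [4, 5, 10], [4, 6, 11], [5, 7, 11], [5, 8, 12], [6, 7, 12], [6, 9, 13], [7, 8, 13],
      [7, 9, 14], [8, 10, 14], [8, 11, 15], [9, 10, 15]], [9, 8, 6, 10], []⟩,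
    ⟨[[1, 3, 10, 4], [2, 4, 9, 5], [3, 6, 12, 8], [5, 7, 6, 10], [0, 2, 9, 3, 7], [1, 7, 12, 5, 8],
      [2, 7, 11, 4, 8], [3, 4, 6, 11, 5]], [6, 5, 4, 7], []⟩,
    ⟨[[0, 2, 9, 3, 7], [1, 3, 10, 5, 4], [1, 7, 13, 6, 8], [2, 4, 11, 6, 5], [2, 7, 12, 5, 8],
      [3, 4, 7, 11, 5], [3, 6, 10, 4, 8], [4, 6, 7, 5, 9], [6, 9, 13, 8, 12]], [7, 8], []⟩,
    ⟨[[0, 2, 4, 3, 7], [1, 3, 6, 11, 7], [1, 4, 7, 2, 8], [2, 5, 10, 4, 9], [3, 5, 11, 4, 8],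
      [3, 9, 5, 6, 10]], [5, 4, 6], []⟩,
    ⟨[[0, 2, 4, 7], [1, 3, 4, 8], [1, 4, 11, 7], [2, 5, 6, 7], [2, 8, 5, 9], [3, 5, 11, 6],
      [3, 7, 12, 8], [3, 9, 4, 10], [5, 10, 6, 12]], [6, 4, 5, 7], []⟩,
    ⟨[[1, 3, 7], [2, 4, 7], [3, 4, 8], [3, 5, 9], [3, 6, 10], [4, 5, 10], [4, 6, 11],
      [0, 2, 5, 11, 7], [1, 4, 9, 2, 8]], [5, 6], []⟩,
    ⟨[[0, 2, 7], [1, 3, 7], [2, 4, 8], [2, 5, 9], [3, 4, 9], [3, 5, 10, 6], [1, 4, 10, 3, 8]],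
      [4, 5], []⟩,
    ⟨[[0, 2, 7], [2, 4, 8], [2, 5, 9], [3, 4, 9], [1, 3, 10, 4], [1, 7, 3, 8], [3, 5, 10, 6]],
      [4, 5], []⟩]
  closingData := [
    ⟨[[2, 5, 10, 6, 9], [3, 4, 11, 5, 9], [3, 5, 8, 12, 6], [4, 6, 13, 7, 10], [4, 7, 8, 13, 9],
      [5, 6, 11, 7, 12]], [10, 9, 8, 6, 7, 5, 4], []⟩,
    ⟨[[2, 5, 11, 6, 9], [3, 4, 5, 6, 10], [3, 6, 12, 8, 9], [4, 7, 12, 5, 10], [4, 9, 5, 7, 11]],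
      [5, 8, 7, 6, 4], []⟩,
    ⟨[[3, 4, 9, 5], [4, 7, 6, 10], [2, 5, 10, 3, 9]], [6, 5, 4], []⟩,
    ⟨[[2, 4, 11, 5, 9], [3, 5, 8, 7, 6], [3, 9, 4, 5, 10], [4, 7, 11, 6, 10]], [4, 6, 5], []⟩,
    ⟨[[2, 4, 5, 9], [3, 5, 10, 6], [3, 9, 4, 10], [4, 7, 6, 11], [5, 8, 7, 11]], [4, 6, 5], []⟩,
    ⟨[[2, 5, 9], [3, 4, 9], [3, 6, 10], [4, 5, 10]], [5, 6, 7, 4], []⟩,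
    ⟨[], [4, 5], []⟩]
  table₀ := [[], [], [], [0], [], [1], [], [2]]
  table := [
    [],
    [],
    [],
    [],
    [],
    [],
    [[205, 701, 6, 502, 303, 104, 600, 401, 202, 3, 0]],
    [[703, 8, 305, 801, 106, 602, 403, 204, 700, 5, 501, 302, 103, 100],
     [306, 802, 107, 603, 205, 701, 502, 303, 104, 600, 401, 202, 3, 0]],
    [[803, 108, 206, 702, 7, 503, 304, 800, 105, 601, 4, 200, 1],
     [109, 406, 902, 703, 8, 801, 602, 403, 204, 700, 5, 501, 302, 103, 100],
     [208, 9, 306, 802, 107, 603, 205, 701, 502, 303, 104, 3, 0]],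
    [[306, 802, 107, 603, 404, 900, 205, 6, 300, 101],
     [209, 803, 702, 503, 304, 800, 105, 601, 4, 200, 1],
     [1003, 109, 406, 902, 703, 8, 801, 602, 403, 204, 5, 100],
     [110, 208, 9, 802, 603, 205, 701, 3, 0]],
    [[207, 703, 8, 2], [211, 12, 802, 603, 404, 900, 205, 6, 300, 101], [209, 803, 105, 4, 200, 1],
     [109, 902, 703, 801, 100], [309, 110, 802, 603, 3, 0]],
    [[], [311, 703, 2], [6], [803, 4, 200, 1], [902, 703, 100], [211, 309, 3]],
    [[0], [313], [2], [], [4, 200, 1], [], [211, 3]],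
    [[], [], [], [2], [], [4], [], [3]],
    [[1], [], [], [], [2], [], [], [], []]]

theorem atlas₇_valid : atlas₇.Valid where
  profiles := by decide +kernel
  nodup := by decide +kernel
  small := by decide +kernel
  card := by decide +kernel
  closed := by decide +kernel
  passing := by decide +kernel
  opening := by decide +kernel
  closing := by decide +kernel
  closed_sum := by decide +kernel
  passing_sum := by decide +kernel
  closed_pure := by rfl
  passing_pure := by rfl
  table₀_length := by decide +kernel
  table_length := by decide +kernel
  cover₀ := by decide +kernel
  cover := by decide +kernel

/-- The atlas for the differences 1, 2, 3, 4, 5, 6, 7, 8. -/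
def atlas₈ : Atlas where
  F :=
    { A := [(1, 1), (2, 1), (3, 1), (4, 0), (5, 3), (6, 2), (7, 1), (8, 0)]
      B := [(1, 2), (2, 3), (3, 1), (4, 0), (5, 3), (6, 2), (7, 1), (8, 0)]
      lo := 2, hi := 5, x := 3, y := 4 }
  N := 8
  d := 17
  closed := [⟨6, 0, 16, 0, 0⟩, ⟨4, 0, 0, 8, 0⟩, ⟨5, 0, 0, 0, 8⟩, ⟨1, 0, 0, 2, 0⟩, ⟨1, 0, 1, 0, 1⟩,
    ⟨2, 0, 4, 1, 0⟩, ⟨3, 0, 0, 1, 4⟩, ⟨4, 0, 9, 0, 1⟩, ⟨9, 0, 24, 0, 0⟩]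
  passing := [⟨6, 6, 14, 0, 0⟩, ⟨4, 4, 0, 7, 0⟩, ⟨5, 5, 0, 0, 7⟩, ⟨9, 9, 21, 0, 0⟩,
    ⟨5, 5, 10, 0, 1⟩, ⟨4, 4, 1, 0, 5⟩, ⟨2, 2, 0, 1, 2⟩, ⟨1, 1, 1, 1, 0⟩]
  opening := [⟨8, 10, 19, 0, 0⟩, ⟨7, 5, 18, 0, 0⟩, ⟨5, 7, 12, 0, 0⟩, ⟨7, 8, 17, 0, 0⟩,
    ⟨6, 6, 0, 0, 9⟩, ⟨5, 4, 13, 0, 0⟩, ⟨5, 7, 0, 9, 0⟩, ⟨2, 3, 4, 1, 0⟩, ⟨3, 5, 4, 0, 2⟩,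
    ⟨4, 6, 0, 6, 1⟩, ⟨2, 4, 0, 0, 3⟩, ⟨1, 3, 1, 0, 1⟩, ⟨1, 3, 0, 2, 0⟩]
  closing := [⟨13, 11, 30, 0, 0⟩, ⟨11, 9, 24, 1, 0⟩, ⟨8, 6, 0, 0, 11⟩, ⟨9, 3, 22, 0, 0⟩,
    ⟨7, 2, 17, 0, 0⟩, ⟨6, 3, 14, 0, 0⟩, ⟨7, 3, 0, 0, 10⟩, ⟨6, 4, 12, 0, 1⟩, ⟨5, 3, 0, 6, 2⟩,
    ⟨5, 2, 0, 0, 7⟩, ⟨5, 3, 3, 0, 5⟩, ⟨5, 3, 2, 7, 0⟩, ⟨3, 1, 0, 5, 0⟩, ⟨3, 1, 2, 1, 2⟩]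
  closedData := [
    [[0, 4, 8], [1, 2, 4], [1, 3, 8], [1, 5, 9], [2, 3, 10], [2, 5, 8], [2, 6, 9], [3, 4, 9],
     [3, 5, 11], [3, 6, 7], [4, 5, 10], [4, 6, 11], [4, 7, 12], [5, 6, 12], [5, 7, 13], [6, 8, 13]],
    [[0, 4, 1, 8], [1, 2, 10, 3], [1, 5, 2, 9], [2, 3, 11, 4], [2, 6, 3, 8], [3, 4, 10, 5],
     [3, 7, 4, 9], [4, 5, 11, 6]],
    [[0, 4, 12, 5, 8], [1, 2, 10, 4, 3], [1, 4, 11, 3, 5], [1, 8, 2, 4, 9], [2, 3, 8, 4, 6],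
     [2, 5, 10, 3, 9], [3, 6, 11, 5, 7], [4, 5, 6, 12, 7]],
    [[0, 4, 1, 8], [1, 2, 8, 3]],
    [[1, 2, 8], [0, 4, 1, 3, 8]],
    [[1, 2, 5], [1, 3, 9], [2, 3, 8], [2, 4, 9], [0, 4, 1, 8]],
    [[2, 6, 3, 8], [0, 4, 3, 1, 8], [1, 2, 3, 9, 4], [1, 5, 10, 2, 9], [2, 4, 10, 3, 5]],
    [[1, 2, 5], [1, 3, 8], [1, 4, 9], [2, 3, 9], [2, 4, 6], [3, 4, 7], [3, 5, 10], [3, 6, 11],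
     [4, 5, 11], [0, 4, 10, 2, 8]],
    [[0, 4, 8], [1, 2, 8], [1, 3, 9], [1, 4, 5], [2, 3, 6], [2, 4, 10], [2, 5, 9], [3, 4, 7],
     [3, 5, 11], [3, 8, 10], [4, 6, 11], [4, 9, 12], [5, 6, 10], [5, 7, 12], [5, 8, 13],
     [6, 7, 13], [6, 8, 12], [6, 9, 14], [7, 8, 14], [7, 9, 11], [7, 10, 15], [8, 9, 15],
     [8, 11, 16], [9, 10, 16]]]
  passingData := [
    ⟨[[0, 4, 8], [1, 4, 9], [1, 5, 8], [2, 3, 8], [2, 5, 10], [2, 6, 9], [3, 4, 10], [3, 5, 11],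
      [3, 7, 9], [4, 6, 11], [4, 7, 12], [5, 6, 12], [5, 7, 13], [6, 8, 13]],
      [6, 7, 8, 10], [5, 9]⟩,
    ⟨[[0, 4, 3, 8], [1, 4, 6, 5], [1, 8, 2, 9], [2, 3, 5, 10], [2, 5, 11, 6], [3, 7, 4, 11],
      [3, 9, 4, 10]], [6, 8], [5, 7]⟩,
    ⟨[[0, 4, 11, 3, 8], [1, 4, 3, 10, 5], [1, 8, 2, 3, 9], [2, 5, 12, 4, 10], [2, 6, 12, 7, 9],
      [3, 5, 4, 7, 6], [4, 6, 11, 5, 8]], [7, 5, 6, 8], [9]⟩,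
    ⟨[[0, 4, 8], [1, 4, 9], [1, 5, 8], [2, 3, 8], [2, 5, 6], [2, 9, 10], [3, 4, 6], [3, 5, 9],
      [3, 7, 11], [4, 7, 12], [4, 10, 11], [5, 7, 13], [5, 10, 12], [6, 8, 12], [6, 9, 14],
      [6, 11, 13], [7, 8, 14], [7, 10, 15], [8, 9, 15], [8, 10, 16], [9, 11, 16]],
      [10, 6, 7, 9, 12], [5, 11, 8, 13]⟩,
    ⟨[[1, 4, 9], [1, 5, 8], [2, 3, 9], [2, 5, 10], [2, 6, 8], [3, 4, 7], [3, 6, 11], [4, 5, 11],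
      [4, 6, 12], [5, 7, 12], [0, 4, 10, 3, 8]], [5, 6, 7, 9], [8]⟩,
    ⟨[[5, 6, 11], [0, 4, 11, 3, 8], [1, 4, 10, 2, 5], [1, 8, 2, 3, 9], [2, 6, 3, 4, 9],
      [3, 7, 4, 5, 10]], [5, 7], [6, 8]⟩,
    ⟨[[2, 8, 3, 9], [0, 4, 9, 1, 8], [1, 4, 3, 2, 5]], [5], [6]⟩,
    ⟨[[2, 3, 8], [0, 4, 1, 8]], [5], []⟩]
  openingData := [
    ⟨[[0, 4, 8], [1, 2, 9], [1, 3, 4], [1, 5, 8], [2, 4, 10], [2, 5, 6], [3, 6, 10], [3, 7, 11],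
      [3, 8, 9], [4, 6, 11], [4, 7, 12], [5, 7, 13], [5, 9, 11], [5, 10, 12], [6, 8, 13],
      [6, 9, 14], [7, 8, 14], [7, 9, 15], [8, 10, 15]], [11, 8, 2, 3, 5, 4, 9, 10, 7, 6, 12], []⟩,
    ⟨[[0, 4, 8], [1, 2, 8], [1, 3, 9], [1, 4, 5], [2, 3, 4], [2, 5, 10], [2, 6, 9], [3, 5, 11],
      [3, 6, 10], [3, 7, 8], [4, 6, 12], [4, 7, 10], [4, 9, 11], [5, 7, 12], [5, 8, 13],
      [6, 7, 13], [6, 8, 14], [7, 9, 14]], [10, 8, 9, 5, 6, 11], []⟩,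
    ⟨[[0, 4, 8], [1, 2, 3], [1, 4, 9], [1, 5, 8], [2, 5, 10], [2, 6, 8], [3, 4, 10], [3, 6, 11],
      [3, 7, 9], [4, 5, 11], [4, 7, 12], [5, 6, 12]], [8, 3, 5, 7, 6, 4, 2, 9], []⟩,
    ⟨[[0, 4, 8], [1, 2, 8], [1, 3, 4], [1, 5, 9], [2, 5, 10], [2, 6, 9], [3, 5, 11], [3, 6, 10],
      [3, 8, 9], [4, 6, 12], [4, 7, 10], [4, 9, 11], [5, 7, 12], [5, 8, 13], [6, 7, 13],
      [6, 8, 14], [7, 9, 14]], [10, 8, 7, 3, 2, 4, 5, 6, 11], []⟩,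
    ⟨[[0, 4, 12, 5, 8], [1, 2, 10, 4, 3], [1, 4, 11, 3, 5], [1, 8, 2, 6, 9], [2, 3, 10, 5, 4],
      [2, 5, 13, 7, 9], [3, 6, 13, 8, 7], [3, 8, 6, 4, 9], [5, 7, 12, 6, 11]],
      [9, 5, 6, 7, 4, 8, 10], []⟩,
    ⟨[[0, 4, 8], [1, 2, 9], [1, 3, 4], [1, 5, 8], [2, 3, 8], [2, 4, 10], [2, 5, 6], [3, 5, 10],
      [3, 6, 11], [3, 7, 9], [4, 5, 11], [4, 6, 12], [5, 7, 12]], [8, 6, 7, 4, 9], []⟩,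
    ⟨[[0, 4, 6, 8], [1, 2, 8, 3], [1, 4, 12, 5], [1, 8, 4, 9], [2, 4, 5, 10], [2, 5, 11, 6],
      [3, 5, 7, 9], [3, 6, 12, 7], [3, 10, 4, 11]], [8, 5, 6, 7, 4, 3, 2, 9], []⟩,
    ⟨[[1, 2, 5], [1, 3, 9], [2, 3, 8], [2, 4, 9], [0, 4, 1, 8]], [5, 3, 4, 6], []⟩,
    ⟨[[1, 2, 5], [1, 3, 8], [3, 4, 9], [3, 5, 10], [0, 4, 10, 2, 8], [1, 4, 6, 2, 9]],
      [6, 3, 2, 4, 5, 7], []⟩,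
    ⟨[[1, 2, 9, 4], [1, 3, 6, 8], [1, 5, 3, 9], [2, 4, 5, 10], [2, 5, 11, 6], [3, 7, 4, 10],
      [0, 4, 11, 3, 8]], [7, 5, 6, 4, 3, 2, 8], []⟩,
    ⟨[[0, 4, 1, 2, 8], [1, 3, 9, 2, 5], [1, 8, 3, 4, 9]], [5, 3, 2, 4, 6], []⟩,
    ⟨[[1, 2, 8], [0, 4, 1, 3, 8]], [4, 2, 3, 5], []⟩,
    ⟨[[0, 4, 1, 8], [1, 2, 8, 3]], [4, 2, 3, 5], []⟩]
  closingData := [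
    ⟨[[0, 4, 8], [1, 4, 5], [1, 8, 9], [2, 3, 9], [2, 5, 10], [2, 6, 8], [3, 4, 11], [3, 6, 7],
      [3, 8, 10], [4, 6, 10], [4, 7, 9], [5, 6, 13], [5, 7, 8], [5, 11, 12], [6, 9, 14],
      [7, 12, 15], [7, 13, 14], [8, 11, 15], [8, 12, 16], [9, 10, 15], [9, 11, 16], [9, 12, 17],
      [10, 11, 17], [10, 12, 18], [10, 13, 16], [11, 13, 18], [11, 14, 19], [12, 13, 19],
      [12, 14, 20], [13, 15, 20]], [12, 6, 11, 7, 10, 14, 8, 13, 9, 5], []⟩,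
    ⟨[[0, 4, 8], [1, 4, 5], [1, 8, 9], [2, 3, 8], [2, 5, 10], [2, 6, 9], [3, 4, 9], [3, 5, 11],
      [3, 7, 10], [4, 6, 10], [4, 7, 12], [5, 6, 12], [5, 9, 13], [6, 8, 13], [6, 11, 14],
      [7, 8, 14], [7, 9, 15], [7, 11, 13], [8, 10, 15], [8, 11, 16], [9, 12, 17], [10, 11, 17],
      [10, 13, 18], [11, 12, 18], [9, 14, 10, 16]], [11, 9, 10, 12, 8, 5, 7, 6], []⟩,
    ⟨[[0, 4, 7, 13, 8], [1, 4, 12, 6, 9], [1, 5, 12, 7, 8], [2, 3, 4, 11, 5], [2, 6, 8, 4, 10],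
      [2, 8, 14, 7, 9], [3, 5, 10, 8, 11], [3, 6, 10, 15, 8], [3, 9, 15, 7, 10], [4, 5, 9, 14, 6],
      [5, 7, 11, 6, 13]], [9, 8, 5, 6, 7], []⟩,
    ⟨[[0, 4, 8], [1, 4, 5], [1, 8, 9], [2, 3, 8], [2, 5, 9], [2, 6, 10], [3, 4, 6], [3, 5, 10],
      [3, 9, 11], [4, 7, 11], [4, 9, 12], [5, 6, 11], [5, 7, 13], [5, 8, 12], [6, 7, 12],
      [6, 8, 13], [6, 9, 14], [7, 8, 14], [7, 9, 15], [8, 10, 15], [8, 11, 16], [9, 10, 16]],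
      [10, 7], []⟩,
    ⟨[[0, 4, 8], [1, 4, 9], [1, 5, 8], [2, 3, 8], [2, 5, 9], [2, 6, 10], [3, 4, 11], [3, 5, 10],
      [3, 7, 9], [4, 5, 12], [4, 7, 10], [5, 6, 11], [5, 7, 13], [6, 7, 12], [6, 8, 13],
      [6, 9, 14], [7, 8, 14]], [6], []⟩,
    ⟨[[0, 4, 8], [1, 4, 9], [1, 5, 8], [2, 3, 8], [2, 5, 10], [2, 6, 9], [3, 4, 10], [3, 5, 9],
      [3, 6, 11], [4, 5, 11], [4, 7, 12], [5, 6, 12], [5, 7, 13], [6, 8, 13]], [6, 7], []⟩,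
    ⟨[[0, 4, 12, 5, 8], [1, 4, 11, 3, 5], [1, 8, 14, 6, 9], [2, 3, 8, 13, 5], [2, 6, 13, 7, 8],
      [2, 9, 3, 7, 10], [3, 4, 7, 5, 10], [4, 5, 11, 6, 10], [4, 6, 12, 7, 9], [5, 6, 7, 14, 9]],
      [8, 6], []⟩,
    ⟨[[0, 4, 8], [1, 4, 9], [2, 3, 8], [2, 5, 10], [2, 6, 9], [3, 4, 10], [3, 5, 9], [3, 6, 11],
      [4, 5, 11], [4, 7, 12], [5, 8, 13], [6, 7, 13], [1, 5, 12, 6, 8]], [6, 5, 7], []⟩,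
    ⟨[[1, 5, 2, 8], [2, 3, 4, 9], [2, 6, 3, 10], [3, 8, 4, 11], [4, 5, 7, 12], [5, 11, 6, 12],
      [0, 4, 10, 5, 8], [1, 4, 7, 3, 9]], [6, 5], []⟩,
    ⟨[[0, 4, 7, 5, 8], [1, 4, 5, 3, 9], [1, 5, 11, 4, 8], [2, 3, 11, 6, 5], [2, 6, 12, 5, 10],
      [2, 8, 3, 4, 9], [3, 7, 12, 4, 10]], [6], []⟩,
    ⟨[[2, 3, 5], [3, 4, 7], [5, 7, 12], [0, 4, 11, 5, 8], [1, 4, 10, 2, 9], [1, 5, 10, 3, 8],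
      [2, 6, 12, 4, 8], [3, 9, 4, 6, 11]], [5, 6], []⟩,
    ⟨[[4, 6, 12], [5, 7, 12], [0, 4, 3, 8], [1, 4, 8, 5], [1, 8, 2, 9], [2, 3, 5, 10],
      [2, 5, 11, 6], [3, 7, 4, 11], [3, 9, 4, 10]], [5, 6], []⟩,
    ⟨[[0, 4, 1, 8], [1, 5, 2, 9], [2, 3, 5, 10], [2, 6, 3, 8], [3, 9, 4, 10]], [], []⟩,
    ⟨[[2, 3, 6], [3, 5, 10], [1, 8, 3, 9], [0, 4, 10, 2, 8], [1, 4, 9, 2, 5]], [], []⟩]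
  table₀ := [[], [], [], [0], [], [100]]
  table := [
    [],
    [],
    [],
    [],
    [],
    [],
    [[306, 107, 404, 303, 600, 401, 202, 3, 300, 101, 0]],
    [[506, 307, 108, 601, 402, 203, 4, 500, 301, 102],
     [109, 406, 207, 504, 403, 700, 5, 501, 302, 103, 400, 100]],
    [[706, 507, 308, 109, 403, 700, 5, 501, 302, 103], [309, 407, 701, 6, 502, 303, 104, 600, 0],
     [408, 209, 10, 506, 503, 800, 105, 601, 402, 203, 200, 1]],
    [[508, 701, 6, 502, 303, 104, 0], [7, 503, 800, 105, 1], [409, 11, 801, 106, 602, 403, 100],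
     [508, 309, 9, 603, 900, 205, 701, 6, 502, 300, 101, 0]],
    [[], [8, 100], [603, 101, 0], [509, 10, 901, 206, 702, 200, 1],
     [510, 703, 8, 1000, 305, 801, 400, 201, 2, 100]],
    [[], [], [200], [11, 201, 2, 100], [9, 1001, 3, 300, 101], [10, 108, 1100, 4, 301, 200]],
    [[], [], [], [12, 3, 300], [4, 301, 102], [400], [110, 401, 0]],
    [[], [], [], [], [5], [], [], [210, 100]],
    [[], [], [], [], [], [], [], [], []],
    [[0], [], [], [0], [], [], [], [], [], [9, 0]],
    [[], [], [], [], [], [], [], [], [0], [], []]]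

theorem atlas₈_valid : atlas₈.Valid where
  profiles := by decide +kernel
  nodup := by decide +kernel
  small := by decide +kernel
  card := by decide +kernel
  closed := by decide +kernel
  passing := by decide +kernel
  opening := by decide +kernel
  closing := by decide +kernel
  closed_sum := by decide +kernel
  passing_sum := by decide +kernel
  closed_pure := by rfl
  passing_pure := by rfl
  table₀_length := by decide +kernel
  table_length := by decide +kernel
  cover₀ := by decide +kernel
  cover := by decide +kernel

/-! ### The connection sets of the theorem -/

/-- The nine columns of `hexagonBlock`, followed by segments of six columns consisting of
triangles. -/
theorem closed_hexagon {n a : ℕ} (hn : 13 ≤ n) (h6 : n % 6 = 3) (ha : 3 * a + 6 = 5 * n) :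
    Closed atlas₅.F n n (short a 0 0 + {6}) := by
  have hblock : Closed atlas₅.F n 9 (short 13 0 0 + {6}) := by
    have h1 : cyclesTest 13 (List.replicate 13 3 ++ [6]) hexagonBlock = true := by decide +kernel
    have h2 : fillsTest atlas₅.F.A atlas₅.F.A 9 (cyclesEdges hexagonBlock) = true := by
      decide +kernel
    obtain ⟨h3, h4⟩ := cycles_of_test hn h1
    exact ⟨hexagonBlock, h3, h4, fills_of_test h2⟩
  have hstrip : Closed atlas₅.F n 6 (short 10 0 0) :=
    (atlas₅_valid.closed_of_mem (t := ⟨6, 0, 10, 0, 0⟩) hn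
      (atlas₅_valid.pure_mem_closed (by simp [atlas₅]))).2
  have key : ∀ j, Closed atlas₅.F n (9 + 6 * j) (short (13 + 10 * j) 0 0 + {6}) := by
    intro j
    induction j with
    | zero => exact hblock
    | succ j ih =>
      have := ih.add hstrip
      rwa [add_right_comm (short _ _ _), short_add] at this
  obtain ⟨j, rfl⟩ : ∃ j, n = 9 + 6 * j := ⟨(n - 9) / 6, by omega⟩
  obtain rfl : a = 13 + 10 * j := by omega
  exact key j

end StripDecomposition

theorem mainTheorem4 (S : Finset ℕ)
    (hS : S = {1, 2, 3} ∨ S = {1, 2, 3, 4} ∨ S = {1, 2, 3, 4, 6} ∨ S = {1, 2, 3, 4, 5, 7} ∨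
      S = {1, 2, 3, 4, 5, 6, 7} ∨ S = {1, 2, 3, 4, 5, 6, 7, 8})
    (n : ℕ) [NeZero n] (hn : 2 * S.sup id + 1 ≤ n)
    (m : List ℕ) (k : ℕ) (hm : ∀ x ∈ m, x = 3 ∨ x = 4 ∨ x = 5) (hk3 : 3 ≤ k) (hkn : k ≤ n)
    (hsum : (m ++ [k]).sum = S.card * n)
    (hexc₁ : ¬ (S = {1, 2, 3, 4, 6} ∧ n ≡ 3 [MOD 6] ∧
      (m ++ [k]).Perm (List.replicate (5 * n / 3) 3)))
    (hexc₂ : ¬ (S = {1, 2, 3, 4, 6} ∧ n ≡ 4 [MOD 6] ∧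
      (m ++ [k]).Perm (List.replicate ((5 * n - 5) / 3) 3 ++ [5]))) :
    HasDecomposition (circ n S) (m ++ [k]) := by
  open StripDecomposition in
  -- all but one of the six cases have neither exceptional lists nor separately treated ones
  have key : ∀ Z : Atlas, Z.Valid → Z.N ≠ 5 → S = (Z.F.A.map Prod.fst).toFinset →
      Z.d ≤ n → S.card = Z.N → HasDecomposition (circ n S) (m ++ [k]) := by
    intro Z hZ hN hSZ hd hcard
    rw [hcard] at hsum
    subst hSZ
    refine hZ.hasDecomposition hd hm hk3 hkn hsum (fun a b c _ _ => ?_)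
      fun a _ h => absurd h hN
    rw [exceptional_eq_false]
    exact fun h => hN h.1
  rcases hS with rfl | rfl | rfl | rfl | rfl | rfl
  · exact key atlas₃ atlas₃_valid (by decide) (by decide) hn (by decide)
  · exact key atlas₄ atlas₄_valid (by decide) (by decide) hn (by decide)
  · have hset : ({1, 2, 3, 4, 6} : Finset ℕ) = (atlas₅.F.A.map Prod.fst).toFinset := by decide
    rw [hset]
    have hsum' : (m ++ [k]).sum = 5 * n := hsum
    refine atlas₅_valid.hasDecomposition hn hm hk3 hkn hsum' ?_
      fun a ha _ h6 => closed_hexagon hn h6 ha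
    intro a b c h hs
    rw [exceptional_eq_false]
    rintro ⟨-, rfl, ⟨rfl, h6⟩ | ⟨rfl, h6⟩⟩
    · have ha : a = 5 * n / 3 := by
        have : 3 * a + 4 * 0 + 5 * 0 = 5 * n := hs
        omega
      refine hexc₁ ⟨rfl, h6, ?_⟩
      rw [← Multiset.coe_eq_coe, h, ha]
      simp [short]
    · have ha : a = (5 * n - 5) / 3 := by
        have : 3 * a + 4 * 0 + 5 * 1 = 5 * n := hs
        omega
      refine hexc₂ ⟨rfl, h6, ?_⟩
      rw [← Multiset.coe_eq_coe, h, ha]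
      simp [short]
  · exact key atlas₆ atlas₆_valid (by decide) (by decide) hn (by decide)
  · exact key atlas₇ atlas₇_valid (by decide) (by decide) hn (by decide)
  · exact key atlas₈ atlas₈_valid (by decide) (by decide) hn (by decide)
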